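/- **Theorem (torsion exponents and generalized boundary depths).** Let $\mathcal K$ be a field, $\Gamma\le\mathbb R$ an additive subgroup, and $\Lambda=\Lambda^{\mathcal K,\Gamma}$ the Novikov field of formal sums $\sum_{g\in\Gamma}a_gT^g$ ($a_g\in\mathcal K$) with $\#\{g : a_g\ne 0,\ g<c\}<\infty$ for every $c\in\mathbb R$, with valuation $\nu(\sum a_gT^g)=\min\{g: a_g\neq 0\}$, $\nu(0)=\infty$. A *filtration function* on a $\Lambda$-vector space $C$ is a function $\ell:C\to\mathbb R\cup\{-\infty\}$ with $\ell(x)=-\infty$ iff $x=0$, $\ell(\lambda x)=\ell(x)-\nu(\lambda)$ and $\ell(x+y)\le\max\{\ell(x),\ell(y)\}$. A finite ordered basis $(w_1,\dots,w_n)$ of $C$ is *orthogonal* if $\ell(\sum_i\lambda_iw_i)=\max_i\ell(\lambda_iw_i)$ for all $\lambda_i\in\Lambda$. A *two-term Floer-type complex* $(C_1\xrightarrow{\partial}C_0)$ consists of finite-dimensional $\Lambda$-vector spaces $C_1,C_0$ with filtration functions (both written $\ell$) that admit orthogonal bases, and a $\Lambda$-linear map $\partial$ with $\ell(\partial x)\le\ell(x)$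 for all $x\in C_1$. For $\delta\in\mathbb R$, a subspace $V\le C_0$ is *$\delta$-robust* if $\ell(y)>\ell(x)+\delta$ whenever $x\in V\setminus\{0\}$, $y\in C_1$ and $\partial y=x$. For an integer $k\ge 1$ the *generalized boundary depth* is $$\beta_k(\partial)=\sup\bigl(\{0\}\cup\{\delta\ge 0 : \text{there is a } \delta\text{-robust subspace } V\le\operatorname{Im}\partial \text{ with } \dim V=k\}\bigr).$$ Let $\Lambda^{univ}=\Lambda^{\mathcal K,\mathbb R}$ and $\Lambda^{univ}_0=\{\lambda\in\Lambda^{univ}:\nu(\lambda)\ge 0\}$. For $j=0,1$ choose an orthogonal ordered basis $(w_1,\dots,w_n)$ of $C_j$, equip $C_j'=C_j\otimes_\Lambda\Lambda^{univ}$ with $\ell'(\sum_i\lambda_i' w_i\otimes 1)=\max_i(\ell(w_i)-\nu(\lambda'_i))$, and let $\bar C'_j=\{c\in C'_j:\ell'(c)\le 0\}$, a $\Lambda^{univ}_0$-module. Then $\partial\otimes 1$ restricts to a $\Lambda^{univ}_0$-linear map $\bar C_1'\to\bar C_0'$. For every two-term Floer-type complex $(C_1\xrightarrow{\partial}C_0)$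 and every choice of orthogonal ordered bases of $C_1$ and $C_0$: 1. there are integers $q,s\ge 0$ and real numbers $\lambda_1\ge\dots\ge\lambda_s>0$ with an isomorphism of $\Lambda^{univ}_0$-modules $$\bar C'_0/(\partial\otimes 1)\bar C'_1\;\cong\;(\Lambda^{univ}_0)^q\oplus\bigoplus_{k=1}^{s}\Lambda^{univ}_0/T^{\lambda_k}\Lambda^{univ}_0;\qquad(*)$$ 2. for every such $q$, $s$, $\lambda_1\ge\dots\ge\lambda_s>0$ with an isomorphism $(*)$, and every integer $k\ge 1$, the $k$-th torsion exponent, which is $\lambda_k$ if $k\le s$ and $0$ if $k>s$, equals $\beta_k(\partial)$. -/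

import Mathlib

open scoped TensorProduct NNReal

noncomputable section

/-! ### Novikov fields -/

/-- `HahnSeries ℝ K` is the field of formal sums `∑ a_g T^g` with well-ordered support in `ℝ`.  A
formal sum is a Novikov series over `Γ` if its exponents lie in `Γ` and, for every real `c`, only
finitely many exponents `g < c` have a nonzero coefficient. -/
def IsNovikov {K : Type*} [Field K] (Γ : AddSubgroup ℝ) (x : HahnSeries ℝ K) : Prop :=
  (∀ g : ℝ, x.coeff g ≠ 0 → g ∈ Γ) ∧ ∀ c : ℝ, {g : ℝ | x.coeff g ≠ 0 ∧ g < c}.Finite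

namespace IsNovikov

variable {K : Type*} [Field K] {Γ : AddSubgroup ℝ}

theorem single {g : ℝ} (hg : g ∈ Γ) (a : K) : IsNovikov Γ (HahnSeries.single g a) := by
  have key : ∀ g' : ℝ, (HahnSeries.single g a).coeff g' ≠ 0 → g' = g := by
    intro g' h
    by_contra hne
    exact h (HahnSeries.coeff_single_of_ne hne)
  refine ⟨fun g' h => (key g' h) ▸ hg, fun c => ?_⟩
  exact (Set.finite_singleton g).subset fun g' h => key g' h.1

theorem zero : IsNovikov Γ (0 : HahnSeries ℝ K) :=
  ⟨fun g h => absurd (HahnSeries.coeff_zero) h, fun c => by simp⟩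

theorem one : IsNovikov Γ (1 : HahnSeries ℝ K) := single Γ.zero_mem 1

theorem add {x y : HahnSeries ℝ K} (hx : IsNovikov Γ x) (hy : IsNovikov Γ y) :
    IsNovikov Γ (x + y) := by
  have key : ∀ g : ℝ, (x + y).coeff g ≠ 0 → x.coeff g ≠ 0 ∨ y.coeff g ≠ 0 := by
    intro g h
    by_contra hcon
    push Not at hcon
    exact h (by rw [HahnSeries.coeff_add, hcon.1, hcon.2, add_zero])
  refine ⟨fun g h => (key g h).elim (hx.1 g) (hy.1 g), fun c => ?_⟩
  refine ((hx.2 c).union (hy.2 c)).subset ?_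
  rintro g ⟨h1, h2⟩
  exact (key g h1).imp (fun h => ⟨h, h2⟩) (fun h => ⟨h, h2⟩)

theorem neg {x : HahnSeries ℝ K} (hx : IsNovikov Γ x) : IsNovikov Γ (-x) := by
  refine ⟨fun g h => hx.1 g (by simpa using h), fun c => (hx.2 c).subset ?_⟩
  rintro g ⟨h1, h2⟩
  exact ⟨by simpa using h1, h2⟩

theorem mul {x y : HahnSeries ℝ K} (hx : IsNovikov Γ x) (hy : IsNovikov Γ y) :
    IsNovikov Γ (x * y) := by
  have key : ∀ g : ℝ, (x * y).coeff g ≠ 0 →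
      ∃ s t : ℝ, x.coeff s ≠ 0 ∧ y.coeff t ≠ 0 ∧ s + t = g := by
    intro g h
    obtain ⟨s, hs, t, ht, hst⟩ := Set.mem_add.1 (HahnSeries.support_mul_subset h)
    exact ⟨s, t, hs, ht, hst⟩
  constructor
  · intro g h
    obtain ⟨s, t, hs, ht, rfl⟩ := key g h
    exact Γ.add_mem (hx.1 s hs) (hy.1 t ht)
  · intro c
    refine (Set.Finite.image2 (fun s t : ℝ => s + t)
      (hx.2 (c - y.order)) (hy.2 (c - x.order))).subset ?_
    rintro g ⟨h1, h2⟩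
    obtain ⟨s, t, hs, ht, rfl⟩ := key g h1
    have h3 := HahnSeries.order_le_of_coeff_ne_zero hs
    have h4 := HahnSeries.order_le_of_coeff_ne_zero ht
    exact ⟨s, ⟨hs, by linarith⟩, t, ⟨ht, by linarith⟩, rfl⟩

theorem pow {x : HahnSeries ℝ K} (hx : IsNovikov Γ x) (n : ℕ) : IsNovikov Γ (x ^ n) := by
  induction n with
  | zero => simpa using one
  | succ n ih => simpa [pow_succ] using ih.mul hx

theorem hsum_powers {z : HahnSeries ℝ K} (hz : IsNovikov Γ z) (h0 : 0 < z.orderTop) :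
    IsNovikov Γ (HahnSeries.SummableFamily.powers z).hsum := by
  have key : ∀ g : ℝ, (HahnSeries.SummableFamily.powers z).hsum.coeff g ≠ 0 →
      ∃ n : ℕ, (z ^ n).coeff g ≠ 0 := by
    intro g h
    obtain ⟨n, hn⟩ := Set.mem_iUnion.1 (HahnSeries.SummableFamily.support_hsum_subset h)
    refine ⟨n, ?_⟩
    rw [HahnSeries.SummableFamily.powers_of_orderTop_pos h0] at hn
    exact hn
  constructor
  · intro g h
    obtain ⟨n, hn⟩ := key g h
    exact (hz.pow n).1 g hn
  · intro c
    rcases eq_or_ne z 0 with rfl | hne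
    · refine (Set.finite_singleton (0 : ℝ)).subset ?_
      rintro g ⟨h1, _⟩
      obtain ⟨n, hn⟩ := key g h1
      rcases Nat.eq_zero_or_pos n with rfl | hpos
      · by_contra hg
        exact hn (by rw [pow_zero, HahnSeries.coeff_one]; exact if_neg hg)
      · exact absurd (by rw [zero_pow hpos.ne', HahnSeries.coeff_zero]) hn
    · have hpos : 0 < z.order := (HahnSeries.zero_lt_orderTop_iff hne).1 h0
      obtain ⟨N, hN⟩ := exists_nat_gt (c / z.order)
      rw [div_lt_iff₀ hpos] at hN
      refine (Set.Finite.biUnion (Set.finite_lt_nat N) fun n _ => (hz.pow n).2 c).subset ?_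
      rintro g ⟨h1, h2⟩
      obtain ⟨n, hn⟩ := key g h1
      refine Set.mem_iUnion₂.2 ⟨n, ?_, hn, h2⟩
      have h3 := HahnSeries.order_le_of_coeff_ne_zero hn
      rw [HahnSeries.order_pow, nsmul_eq_mul] at h3
      have h5 : (n : ℝ) * z.order < N * z.order := by linarith
      exact_mod_cast lt_of_mul_lt_mul_right h5 hpos.le

theorem inv {x : HahnSeries ℝ K} (hx : IsNovikov Γ x) : IsNovikov Γ x⁻¹ := by
  rcases eq_or_ne x 0 with rfl | hne
  · simpa using zero
  · have ho : x.order ∈ Γ := hx.1 _ (HahnSeries.coeff_order_eq_zero.not.2 hne)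
    have hs : IsNovikov Γ (HahnSeries.single (-x.order) (x.leadingCoeff)⁻¹) :=
      single (Γ.neg_mem ho) _
    rw [HahnSeries.inv_def]
    refine hs.mul (hsum_powers ?_ ?_)
    · rw [sub_eq_add_neg]
      exact one.add (hs.mul hx).neg
    · exact HahnSeries.unit_aux x (inv_mul_cancel₀ (HahnSeries.leadingCoeff_ne_zero.mpr hne)) _
        (neg_add_cancel x.order)

end IsNovikov

/-- The Novikov series over `Γ`, as a subfield of `HahnSeries ℝ K`. -/
def novikovSubfield (K : Type*) [Field K] (Γ : AddSubgroup ℝ) : Subfield (HahnSeries ℝ K) where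
  carrier := {x | IsNovikov Γ x}
  mul_mem' := IsNovikov.mul
  one_mem' := IsNovikov.one
  add_mem' := IsNovikov.add
  zero_mem' := IsNovikov.zero
  neg_mem' := IsNovikov.neg
  inv_mem' := fun _ => IsNovikov.inv

/-- The Novikov field `Λ^{K,Γ}`. -/
def NovikovField (K : Type*) [Field K] (Γ : AddSubgroup ℝ) : Type _ := novikovSubfield K Γ

instance (K : Type*) [Field K] (Γ : AddSubgroup ℝ) : Field (NovikovField K Γ) :=
  inferInstanceAs (Field (novikovSubfield K Γ))

/-- The formal sum underlying an element of `Λ^{K,Γ}`. -/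
def NovikovField.toHahnSeries {K : Type*} [Field K] {Γ : AddSubgroup ℝ} :
    NovikovField K Γ →+* HahnSeries ℝ K :=
  (novikovSubfield K Γ).subtype

/-- The universal Novikov field `Λ^{univ} = Λ^{K,ℝ}`. -/
abbrev UnivNovikov (K : Type*) [Field K] : Type _ := NovikovField K ⊤

section Novikov

variable {K : Type*} [Field K] {Γ : AddSubgroup ℝ}

theorem novikovSubfield_le_top : novikovSubfield K Γ ≤ novikovSubfield K ⊤ :=
  fun _ hx => ⟨fun _ _ => trivial, hx.2⟩

/-- The field extension `Λ^{K,Γ} ↪ Λ^{univ}`, given by the inclusion. -/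
instance : Algebra (NovikovField K Γ) (UnivNovikov K) :=
  RingHom.toAlgebra
    (show NovikovField K Γ →+* UnivNovikov K from Subfield.inclusion novikovSubfield_le_top)

/-- The valuation `ν`: the least exponent with a nonzero coefficient, and `ν 0 = ∞`. -/
def novikovVal (a : NovikovField K Γ) : WithTop ℝ := a.toHahnSeries.orderTop

/-- `-ν`, with values in `ℝ ∪ {-∞}`. -/
def novikovNegVal (a : NovikovField K Γ) : WithBot ℝ :=
  match novikovVal a with
  | ⊤ => ⊥
  | (r : ℝ) => ((-r : ℝ) : WithBot ℝ)

theorem novikovNegVal_le_coe_iff {a : NovikovField K Γ} {c : ℝ} :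
    novikovNegVal a ≤ (c : WithBot ℝ) ↔ ((-c : ℝ) : WithTop ℝ) ≤ novikovVal a := by
  unfold novikovNegVal
  cases novikovVal a with
  | top => simp
  | coe r => simp only [WithBot.coe_le_coe, WithTop.coe_le_coe]; constructor <;> intro h <;> linarith

theorem novikovNegVal_add_le (a b : NovikovField K Γ) :
    novikovNegVal (a + b) ≤ max (novikovNegVal a) (novikovNegVal b) := by
  have h : min (novikovVal a) (novikovVal b) ≤ novikovVal (a + b) :=
    HahnSeries.min_orderTop_le_orderTop_add
  unfold novikovNegVal
  revert h
  cases novikovVal a <;> cases novikovVal b <;> cases novikovVal (a + b) <;>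
    simp

theorem novikovNegVal_mul (a b : NovikovField K Γ) :
    novikovNegVal (a * b) = novikovNegVal a + novikovNegVal b := by
  have h : novikovVal (a * b) = novikovVal a + novikovVal b :=
    HahnSeries.orderTop_mul _ _
  unfold novikovNegVal
  rw [h]
  cases novikovVal a <;> cases novikovVal b <;> try rfl
  rename_i r s
  change ((-(r + s) : ℝ) : WithBot ℝ) = ((-r + -s : ℝ) : WithBot ℝ)
  rw [neg_add]

theorem novikovNegVal_zero : novikovNegVal (0 : NovikovField K Γ) = ⊥ := by
  have h : novikovVal (0 : NovikovField K Γ) = ⊤ := HahnSeries.orderTop_zero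
  unfold novikovNegVal
  rw [h]

theorem novikovNegVal_algebraMap (a : NovikovField K Γ) :
    novikovNegVal (algebraMap (NovikovField K Γ) (UnivNovikov K) a) = novikovNegVal a := rfl

variable (K) in
/-- The ring `Λ^{univ}_0` of elements of `Λ^{univ}` with `ν ≥ 0`. -/
def univNovikovZero : Subring (UnivNovikov K) where
  carrier := {a | 0 ≤ novikovVal a}
  mul_mem' {a b} ha hb := by
    have h : novikovVal (a * b) = novikovVal a + novikovVal b := HahnSeries.orderTop_mul _ _
    change 0 ≤ novikovVal (a * b)
    rw [h]
    exact add_nonneg ha hb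
  one_mem' := by
    have h : novikovVal (1 : UnivNovikov K) = 0 := HahnSeries.orderTop_one
    change 0 ≤ novikovVal (1 : UnivNovikov K)
    rw [h]
  add_mem' {a b} ha hb := by
    have h : min (novikovVal a) (novikovVal b) ≤ novikovVal (a + b) :=
      HahnSeries.min_orderTop_le_orderTop_add
    exact le_trans (le_min ha hb) h
  zero_mem' := by
    have h : novikovVal (0 : UnivNovikov K) = ⊤ := HahnSeries.orderTop_zero
    change 0 ≤ novikovVal (0 : UnivNovikov K)
    rw [h]
    exact le_top
  neg_mem' {a} ha := by
    have h : novikovVal (-a) = novikovVal a := HahnSeries.orderTop_neg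
    change 0 ≤ novikovVal (-a)
    rw [h]
    exact ha

variable (K) in
/-- The element `T^c` of `Λ^{univ}_0`, for `c ≥ 0`. -/
def univNovikovT (c : ℝ≥0) : univNovikovZero K :=
  ⟨⟨HahnSeries.single (c : ℝ) 1, IsNovikov.single (AddSubgroup.mem_top _) 1⟩, by
    have h : novikovVal (⟨HahnSeries.single (c : ℝ) 1,
        IsNovikov.single (AddSubgroup.mem_top _) 1⟩ : UnivNovikov K) = ((c : ℝ) : WithTop ℝ) :=
      HahnSeries.orderTop_single one_ne_zero
    refine le_of_le_of_eq ?_ h.symm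
    exact_mod_cast c.2⟩

end Novikov

/-! ### Non-Archimedean normed vector spaces -/

section Spaces

variable {K : Type*} [Field K] {Γ : AddSubgroup ℝ} {C : Type*} [AddCommGroup C]
  [Module (NovikovField K Γ) C]

/-- `(C, ℓ)` is a non-Archimedean normed vector space over `Λ^{K,Γ}`. -/
structure IsFiltrationFunction (ℓ : C → WithBot ℝ) : Prop where
  eq_bot_iff : ∀ x : C, ℓ x = ⊥ ↔ x = 0
  smul : ∀ (a : NovikovField K Γ) (x : C), ℓ (a • x) = ℓ x + novikovNegVal a
  add_le : ∀ x y : C, ℓ (x + y) ≤ max (ℓ x) (ℓ y)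

/-- Orthogonality of a finite ordered collection; the maximum over the empty set is `-∞`. -/
def IsOrthogonal (ℓ : C → WithBot ℝ) {n : ℕ} (w : Fin n → C) : Prop :=
  ∀ a : Fin n → NovikovField K Γ,
    ℓ (∑ i, a i • w i) = Finset.univ.sup fun i => ℓ (a i • w i)

/-- `(C, ℓ)` is an orthogonalizable `Λ^{K,Γ}`-space; finite-dimensionality is contained in the
existence of a finite basis. -/
structure IsOrthogonalizable (ℓ : C → WithBot ℝ) : Prop extends IsFiltrationFunction (K := K) (Γ := Γ) ℓ where
  exists_basis : ∃ (n : ℕ) (w : Module.Basis (Fin n) (NovikovField K Γ) C),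
    IsOrthogonal (K := K) (Γ := Γ) ℓ w

variable (K Γ C) in
/-- The coefficient extension `C' = C ⊗ Λ^{univ}`, a vector space over `Λ^{univ}`. -/
def CoeffExt : Type _ := UnivNovikov K ⊗[NovikovField K Γ] C

instance : AddCommGroup (CoeffExt K Γ C) :=
  inferInstanceAs (AddCommGroup (UnivNovikov K ⊗[NovikovField K Γ] C))

instance : Module (UnivNovikov K) (CoeffExt K Γ C) :=
  inferInstanceAs (Module (UnivNovikov K) (UnivNovikov K ⊗[NovikovField K Γ] C))

/-- The basis `w_i ⊗ 1` of `C'`. -/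
def CoeffExt.basis {n : ℕ} (w : Module.Basis (Fin n) (NovikovField K Γ) C) :
    Module.Basis (Fin n) (UnivNovikov K) (CoeffExt K Γ C) :=
  w.baseChange (UnivNovikov K)

variable (K Γ) in
/-- The element `x ⊗ 1` of `C'`. -/
def CoeffExt.of (x : C) : CoeffExt K Γ C := 1 ⊗ₜ[NovikovField K Γ] x

/-- The map `f ⊗ 1 : C' → D'`. -/
def CoeffExt.map {D : Type*} [AddCommGroup D] [Module (NovikovField K Γ) D]
    (f : C →ₗ[NovikovField K Γ] D) : CoeffExt K Γ C →ₗ[UnivNovikov K] CoeffExt K Γ D :=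
  f.baseChange (UnivNovikov K)

theorem CoeffExt.basis_apply {n : ℕ} (w : Module.Basis (Fin n) (NovikovField K Γ) C) (i : Fin n) :
    CoeffExt.basis w i = CoeffExt.of K Γ (w i) :=
  Module.Basis.baseChange_apply (UnivNovikov K) w i

theorem CoeffExt.basis_repr_of {n : ℕ} (w : Module.Basis (Fin n) (NovikovField K Γ) C) (x : C)
    (i : Fin n) : (CoeffExt.basis w).repr (CoeffExt.of K Γ x) i =
      algebraMap (NovikovField K Γ) (UnivNovikov K) (w.repr x i) :=
  (Module.Basis.baseChange_repr_tmul (UnivNovikov K) w 1 x i).trans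
    (Algebra.algebraMap_eq_smul_one _).symm

theorem CoeffExt.map_of {D : Type*} [AddCommGroup D] [Module (NovikovField K Γ) D]
    (f : C →ₗ[NovikovField K Γ] D) (x : C) :
    CoeffExt.map f (CoeffExt.of K Γ x) = CoeffExt.of K Γ (f x) :=
  LinearMap.baseChange_tmul (A := UnivNovikov K) f 1 x

/-- The filtration function `ℓ'` on `C' = C ⊗ Λ^{univ}` attached to an ordered basis `w` of `C`:
`ℓ' (∑ a_i w_i ⊗ 1) = max_i (ℓ w_i - ν a_i)`. -/
def extFiltration (ℓ : C → WithBot ℝ) {n : ℕ} (w : Module.Basis (Fin n) (NovikovField K Γ) C)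
    (c : CoeffExt K Γ C) : WithBot ℝ :=
  Finset.univ.sup fun i =>
    ℓ (w i) + novikovNegVal ((CoeffExt.basis w).repr c i)

variable (ℓ : C → WithBot ℝ) {n : ℕ} (w : Module.Basis (Fin n) (NovikovField K Γ) C)

theorem extFiltration_zero : extFiltration ℓ w 0 = ⊥ := by
  unfold extFiltration
  simp [novikovNegVal_zero]

theorem extFiltration_add_le (c d : CoeffExt K Γ C) :
    extFiltration ℓ w (c + d) ≤ max (extFiltration ℓ w c) (extFiltration ℓ w d) := by
  refine Finset.sup_le fun i _ => ?_
  rw [map_add, Finsupp.add_apply]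
  refine (add_le_add_right (novikovNegVal_add_le _ _) _).trans ?_
  rw [← max_add_add_left]
  exact max_le_max
    (Finset.le_sup (f := fun i => ℓ (w i) + novikovNegVal ((CoeffExt.basis w).repr c i))
      (Finset.mem_univ i))
    (Finset.le_sup (f := fun i => ℓ (w i) + novikovNegVal ((CoeffExt.basis w).repr d i))
      (Finset.mem_univ i))

theorem extFiltration_smul_le (a : UnivNovikov K) (c : CoeffExt K Γ C) :
    extFiltration ℓ w (a • c) ≤ extFiltration ℓ w c + novikovNegVal a := by
  refine Finset.sup_le fun i _ => ?_
  rw [map_smul, Finsupp.smul_apply, smul_eq_mul, novikovNegVal_mul, add_comm (novikovNegVal a),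
    ← add_assoc]
  exact add_le_add_left
    (Finset.le_sup (f := fun i => ℓ (w i) + novikovNegVal ((CoeffExt.basis w).repr c i))
      (Finset.mem_univ i)) _

theorem extFiltration_sum_le {ι : Type*} (s : Finset ι)
    (f : ι → CoeffExt K Γ C) :
    extFiltration ℓ w (∑ i ∈ s, f i) ≤ s.sup fun i => extFiltration ℓ w (f i) := by
  classical
  induction s using Finset.induction_on with
  | empty => simp [extFiltration_zero]
  | insert i s hi ih =>
    rw [Finset.sum_insert hi, Finset.sup_insert]
    exact (extFiltration_add_le ℓ w _ _).trans (max_le_max le_rfl ih)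

variable {ℓ} {w} in
theorem extFiltration_tmul (h : IsFiltrationFunction (K := K) (Γ := Γ) ℓ)
    (hw : IsOrthogonal (K := K) (Γ := Γ) ℓ w) (x : C) :
    extFiltration ℓ w (CoeffExt.of K Γ x) = ℓ x := by
  conv_rhs => rw [← w.sum_repr x]
  rw [hw]
  unfold extFiltration
  refine Finset.sup_congr rfl fun i _ => ?_
  rw [h.smul, CoeffExt.basis_repr_of, novikovNegVal_algebraMap]

/-- `C̄' = {c ∈ C' | ℓ' c ≤ 0}`, a module over `Λ^{univ}_0`. -/
def filteredPart : Submodule (univNovikovZero K) (CoeffExt K Γ C) where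
  carrier := {c | extFiltration ℓ w c ≤ 0}
  zero_mem' := by
    change extFiltration ℓ w 0 ≤ 0
    rw [extFiltration_zero]
    exact bot_le
  add_mem' {c d} hc hd := (extFiltration_add_le ℓ w c d).trans (max_le hc hd)
  smul_mem' a c hc := by
    refine (extFiltration_smul_le ℓ w (a : UnivNovikov K) c).trans ?_
    refine add_nonpos hc ?_
    have := (novikovNegVal_le_coe_iff (a := (a : UnivNovikov K)) (c := 0)).2
      (by rw [neg_zero]; exact a.2)
    exact this

end Spaces

/-! ### Two-term Floer-type complexes -/

/-- A two-term Floer-type complex `∂ : C₁ → C₀` over `Λ^{K,Γ}` with filtration functions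
`ℓ₁`, `ℓ₀`. -/
structure TwoTermFloerComplex (K : Type*) [Field K] (Γ : AddSubgroup ℝ) (C₁ C₀ : Type*)
    [AddCommGroup C₁] [Module (NovikovField K Γ) C₁]
    [AddCommGroup C₀] [Module (NovikovField K Γ) C₀] where
  ℓ₁ : C₁ → WithBot ℝ
  ℓ₀ : C₀ → WithBot ℝ
  orthogonalizable₁ : IsOrthogonalizable (K := K) (Γ := Γ) ℓ₁
  orthogonalizable₀ : IsOrthogonalizable (K := K) (Γ := Γ) ℓ₀
  /-- the boundary operator -/
  d : C₁ →ₗ[NovikovField K Γ] C₀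
  d_le : ∀ x : C₁, ℓ₀ (d x) ≤ ℓ₁ x

namespace TwoTermFloerComplex

variable {K : Type*} [Field K] {Γ : AddSubgroup ℝ} {C₁ C₀ : Type*}
  [AddCommGroup C₁] [Module (NovikovField K Γ) C₁]
  [AddCommGroup C₀] [Module (NovikovField K Γ) C₀] (X : TwoTermFloerComplex K Γ C₁ C₀)

/-- `x ∈ C₀` is `δ`-robust. -/
def IsRobust (δ : ℝ) (x : C₀) : Prop :=
  ∀ y : C₁, X.d y = x → X.ℓ₀ x + (δ : WithBot ℝ) < X.ℓ₁ y

/-- A subspace of `C₀` is `δ`-robust if all its nonzero elements are. -/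
def IsRobustSubspace (δ : ℝ) (V : Submodule (NovikovField K Γ) C₀) : Prop :=
  ∀ x ∈ V, x ≠ 0 → X.IsRobust δ x

/-- The generalized boundary depth `β_k(∂)`, as a supremum in the extended reals. -/
def boundaryDepth (k : ℕ) : EReal :=
  sSup ({0} ∪ {b : EReal | ∃ δ : ℝ, 0 ≤ δ ∧ b = (δ : EReal) ∧
    ∃ V : Submodule (NovikovField K Γ) C₀, V ≤ LinearMap.range X.d ∧
      X.IsRobustSubspace δ V ∧ Module.finrank (NovikovField K Γ) V = k})

variable {n₁ n₀ : ℕ} {w₁ : Module.Basis (Fin n₁) (NovikovField K Γ) C₁}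
  {w₀ : Module.Basis (Fin n₀) (NovikovField K Γ) C₀}

theorem extFiltration_baseChange_le
    (hw₀ : IsOrthogonal (K := K) (Γ := Γ) X.ℓ₀ w₀) (c : CoeffExt K Γ C₁) :
    extFiltration X.ℓ₀ w₀ (CoeffExt.map X.d c) ≤ extFiltration X.ℓ₁ w₁ c := by
  conv_lhs => rw [← (CoeffExt.basis w₁).sum_repr c]
  rw [map_sum]
  refine (extFiltration_sum_le _ _ _ _).trans (Finset.sup_mono_fun fun i _ => ?_)
  rw [map_smul, CoeffExt.basis_apply, CoeffExt.map_of]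
  refine (extFiltration_smul_le _ _ _ _).trans (add_le_add_left ?_ _)
  rw [extFiltration_tmul X.orthogonalizable₀.toIsFiltrationFunction hw₀]
  exact X.d_le _

variable (w₁) in
/-- The map `∂ ⊗ 1 : C̄'₁ → C̄'₀` of `Λ^{univ}_0`-modules. -/
def filteredBoundary (hw₀ : IsOrthogonal (K := K) (Γ := Γ) X.ℓ₀ w₀) :
    filteredPart X.ℓ₁ w₁ →ₗ[univNovikovZero K] filteredPart X.ℓ₀ w₀ :=
  LinearMap.restrict ((CoeffExt.map X.d).restrictScalars (univNovikovZero K))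
    (fun c hc => (X.extFiltration_baseChange_le hw₀ c).trans hc)

variable (w₁) in
/-- `λ₁ ≥ ⋯ ≥ λ_s > 0` (indexed from `0` here) are the exponents of a decomposition
`C̄'₀ / (∂ ⊗ 1) C̄'₁ ≅ (Λ^{univ}_0)^q ⊕ ⨁ₖ Λ^{univ}_0 / T^{λ_k} Λ^{univ}_0`. -/
def IsTorsionDecomposition (hw₀ : IsOrthogonal (K := K) (Γ := Γ) X.ℓ₀ w₀)
    (q s : ℕ) (lam : Fin s → ℝ≥0) : Prop :=
  Antitone lam ∧ (∀ i, 0 < lam i) ∧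
    Nonempty ((filteredPart X.ℓ₀ w₀ ⧸ LinearMap.range (X.filteredBoundary w₁ hw₀))
      ≃ₗ[univNovikovZero K]
      (Fin q → univNovikovZero K) ×
        ((i : Fin s) → univNovikovZero K ⧸ Ideal.span {univNovikovT K (lam i)}))

end TwoTermFloerComplex

/-- The `k`th torsion exponent (`k ≥ 1`) read off from `λ₁ ≥ ⋯ ≥ λ_s`: it is `λ_k` if `k ≤ s`, and
`0` otherwise. -/
def torsionExponent {s : ℕ} (lam : Fin s → ℝ≥0) (k : ℕ) : ℝ :=
  if h : 1 ≤ k ∧ k ≤ s then (lam ⟨k - 1, by omega⟩ : ℝ) else 0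

end

open scoped TensorProduct NNReal

noncomputable section

/-! ### The negated valuation -/

section NegVal

variable {K : Type*} [Field K] {Γ : AddSubgroup ℝ}

/-! Gaussian elimination with full pivoting gives `∂` a non-Archimedean singular value decomposition
(`exists_singular_value_decomposition`): orthogonal bases `y` of `C₁` and `x` of `C₀` with `∂ y_i =
x_i` for `i` in `ρ` and `∂ y_j = 0` for the remaining `j`. Both invariants in the theorem are
determined by the gaps `g_i = ℓ y_i - ℓ x_i ≥ 0`, through the counting function `N(t) = #{i | t <
g_i}`.

Algebraic side: the filtered part is free on the rescaled vectors `T^{ℓ x_i} x_i` for any orthogonal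
basis (`exists_filteredPart_equiv`), and in these coordinates `∂ ⊗ 1` is diagonal with entries
`T^{g_i}`. So the cokernel is the sum of the modules `Λ₀/T^{g_i}` and one free summand for each
element of `β`; discarding zero gaps and sorting gives existence. For uniqueness, over a local ring
the number of cyclic summands `R/I_i` not killed by a given `c` depends only on the module
(`IsCyclicPresentation.card_eq`): it is the minimal number of generators of `cM`. Taking `c = T^t`
gives `q + #{k | t < λ_k} = |β| + N(t)`; a large `t` gives `q = |β|`, so the two counting functions
agree (`card_gap_eq`).

Metric side: a `δ`-robust `k`-dimensional subspace of the image exists iff `k ≤ N(δ)`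
(`exists_isRobustSubspace_iff`). The `x_i` with `g_i > δ` span a robust space, and any larger space
contains a nonzero vector without components along them, which has a primitive at most `δ` above it.
Hence such subspaces exist exactly for `0 ≤ δ < λ_k`, and the supremum is `λ_k`. -/

theorem novikovNegVal_eq_bot_iff {a : NovikovField K Γ} : novikovNegVal a = ⊥ ↔ a = 0 := by
  have h : novikovVal a = ⊤ ↔ a = 0 := by
    unfold novikovVal
    rw [HahnSeries.orderTop_eq_top]
    exact map_eq_zero _
  rw [← h]
  unfold novikovNegVal
  cases novikovVal a <;> simp

theorem exists_novikovNegVal_eq {a : NovikovField K Γ} (ha : a ≠ 0) :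
    ∃ r : ℝ, novikovNegVal a = (r : WithBot ℝ) := by
  obtain ⟨r, hr⟩ := WithBot.ne_bot_iff_exists.1 (mt novikovNegVal_eq_bot_iff.1 ha)
  exact ⟨r, hr.symm⟩

theorem novikovNegVal_one : novikovNegVal (1 : NovikovField K Γ) = 0 := by
  have h : novikovVal (1 : NovikovField K Γ) = ((0 : ℝ) : WithTop ℝ) := HahnSeries.orderTop_one
  unfold novikovNegVal
  rw [h]
  simp

theorem novikovNegVal_neg (a : NovikovField K Γ) : novikovNegVal (-a) = novikovNegVal a := by
  have h : novikovVal (-a) = novikovVal a := HahnSeries.orderTop_neg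
  unfold novikovNegVal
  rw [h]

theorem novikovNegVal_div {a b : NovikovField K Γ} {r s : ℝ}
    (ha : novikovNegVal a = (r : WithBot ℝ)) (hb : novikovNegVal b = (s : WithBot ℝ)) :
    novikovNegVal (a / b) = ((r - s : ℝ) : WithBot ℝ) := by
  have hb0 : b ≠ 0 := by
    rintro rfl
    simp [novikovNegVal_zero] at hb
  have ha0 : a ≠ 0 := by
    rintro rfl
    simp [novikovNegVal_zero] at ha
  obtain ⟨t, ht⟩ := exists_novikovNegVal_eq (div_ne_zero ha0 hb0)
  have h := novikovNegVal_mul (a / b) b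
  rw [div_mul_cancel₀ a hb0, ha, hb, ht, ← WithBot.coe_add, WithBot.coe_inj] at h
  rw [ht, h, add_sub_cancel_right]

end NegVal

/-! ### Orthogonal families -/

section Orthogonal

variable {K : Type*} [Field K] {Γ : AddSubgroup ℝ} {C : Type*} [AddCommGroup C]
  [Module (NovikovField K Γ) C] {ℓ : C → WithBot ℝ}

namespace IsFiltrationFunction

variable (h : IsFiltrationFunction (K := K) (Γ := Γ) ℓ)
include h

theorem map_zero : ℓ 0 = ⊥ := (h.eq_bot_iff 0).2 rfl

theorem map_neg (x : C) : ℓ (-x) = ℓ x := by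
  have := h.smul (-1) x
  rwa [neg_one_smul, novikovNegVal_neg, novikovNegVal_one, add_zero] at this

theorem sub_le (x y : C) : ℓ (x - y) ≤ max (ℓ x) (ℓ y) := by
  rw [sub_eq_add_neg, ← h.map_neg y]
  exact h.add_le _ _

theorem exists_eq_coe {x : C} (hx : x ≠ 0) : ∃ r : ℝ, ℓ x = (r : WithBot ℝ) := by
  obtain ⟨r, hr⟩ := WithBot.ne_bot_iff_exists.1 (mt (h.eq_bot_iff x).1 hx)
  exact ⟨r, hr.symm⟩

theorem sum_le {ι : Type*} (s : Finset ι) (f : ι → C) {m : WithBot ℝ}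
    (hm : ∀ i ∈ s, ℓ (f i) ≤ m) : ℓ (∑ i ∈ s, f i) ≤ m := by
  classical
  induction s using Finset.induction_on with
  | empty => simp [h.map_zero]
  | insert i s hi ih =>
    rw [Finset.sum_insert hi]
    exact (h.add_le _ _).trans (max_le (hm i (Finset.mem_insert_self i s))
      (ih fun j hj => hm j (Finset.mem_insert_of_mem hj)))

end IsFiltrationFunction

variable (K Γ) in
/-- Orthogonality of a finite family: no term of a linear combination exceeds the sum. -/
def IsOrthogonalFamily (ℓ : C → WithBot ℝ) {ι : Type*} [Fintype ι] (w : ι → C) : Prop :=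
  ∀ (a : ι → NovikovField K Γ) (i : ι), ℓ (a i • w i) ≤ ℓ (∑ j, a j • w j)

theorem IsOrthogonal.isOrthogonalFamily {n : ℕ} {w : Fin n → C}
    (hw : IsOrthogonal (K := K) (Γ := Γ) ℓ w) : IsOrthogonalFamily K Γ ℓ w := fun a i => by
  rw [hw a]
  exact Finset.le_sup (f := fun i => ℓ (a i • w i)) (Finset.mem_univ i)

namespace IsOrthogonalFamily

variable {ι κ : Type*} [Fintype ι] [Fintype κ] {w : ι → C}

theorem comp_equiv (hw : IsOrthogonalFamily K Γ ℓ w) (e : κ ≃ ι) :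
    IsOrthogonalFamily K Γ ℓ (w ∘ e) := fun a k => by
  have h := hw (a ∘ e.symm) (e k)
  rw [← e.sum_comp] at h
  simpa using h

theorem linearIndependent (h : IsFiltrationFunction (K := K) (Γ := Γ) ℓ)
    (hw : IsOrthogonalFamily K Γ ℓ w) (h0 : ∀ i, w i ≠ 0) :
    LinearIndependent (NovikovField K Γ) w := by
  rw [Fintype.linearIndependent_iff]
  intro a ha i
  have h1 := hw a i
  rw [ha, h.map_zero, le_bot_iff, h.eq_bot_iff, smul_eq_zero] at h1
  exact h1.resolve_right (h0 i)

theorem exists_basis [Nonempty ι] (h : IsFiltrationFunction (K := K) (Γ := Γ) ℓ)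
    (hw : IsOrthogonalFamily K Γ ℓ w) (h0 : ∀ i, w i ≠ 0)
    (b : Module.Basis ι (NovikovField K Γ) C) :
    ∃ b' : Module.Basis ι (NovikovField K Γ) C, ⇑b' = w :=
  ⟨basisOfLinearIndependentOfCardEqFinrank (hw.linearIndependent h h0)
    (Module.finrank_eq_card_basis b).symm, coe_basisOfLinearIndependentOfCardEqFinrank _ _⟩

/-- Replacing one member by a vector in which that member is a dominant term. -/
theorem update [DecidableEq ι] (h : IsFiltrationFunction (K := K) (Γ := Γ) ℓ)
    (hw : IsOrthogonalFamily K Γ ℓ w) (i : ι) (b : ι → NovikovField K Γ) {z : C}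
    (hz : z = ∑ k, b k • w k) (hi : ℓ z = ℓ (b i • w i)) :
    IsOrthogonalFamily K Γ ℓ (Function.update w i z) := by
  intro a
  set m := ℓ (∑ k, a k • Function.update w i z k) with hm
  -- In the old family the coefficient at `k ≠ i` is `a k + a i * b k`, and at `i` it is `a i * b
  -- i`; `Function.update a i 0` covers both cases in one formula.
  have hsum : ∑ k, a k • Function.update w i z k =
      ∑ k, (Function.update a i 0 k + a i * b k) • w k := by
    have h1 : ∑ k, a k • Function.update w i z k =
        ∑ k, Function.update a i 0 k • w k + a i • z := by
      rw [← Finset.add_sum_erase _ _ (Finset.mem_univ i),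
        ← Finset.add_sum_erase _ (fun k => Function.update a i 0 k • w k) (Finset.mem_univ i)]
      simp only [Function.update_self, zero_smul, zero_add]
      rw [add_comm]
      congr 1
      refine Finset.sum_congr rfl fun k hk => ?_
      rw [Function.update_of_ne (Finset.ne_of_mem_erase hk),
        Function.update_of_ne (Finset.ne_of_mem_erase hk)]
    rw [h1, hz, Finset.smul_sum, ← Finset.sum_add_distrib]
    exact Finset.sum_congr rfl fun k _ => by rw [add_smul, mul_smul]
  have hk : ∀ k, ℓ ((Function.update a i 0 k + a i * b k) • w k) ≤ m := fun k => by
    rw [hm, hsum]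
    exact hw (fun k => Function.update a i 0 k + a i * b k) k
  -- The `i`-th old term is `a i * b i` times `w i`, which has the level of `a i • z` because `w i`
  -- is dominant in `z`. This bounds every other component of `a i • z` as well.
  have hiz : ℓ (a i • z) ≤ m := by
    have h1 := hk i
    rw [Function.update_self, zero_add, mul_smul] at h1
    rwa [h.smul, hi, ← h.smul]
  intro k
  by_cases hki : k = i
  · subst hki
    rwa [Function.update_self]
  · rw [Function.update_of_ne hki]
    have h1 : ℓ (a i • b k • w k) ≤ m := by
      refine le_trans ?_ hiz
      rw [h.smul, h.smul _ z]
      refine add_le_add_left ?_ _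
      rw [hz]
      exact hw b k
    have h2 : a k • w k = (Function.update a i 0 k + a i * b k) • w k - a i • b k • w k := by
      rw [Function.update_of_ne hki, add_smul, mul_smul, add_sub_cancel_right]
    rw [h2]
    exact (h.sub_le _ _).trans (max_le (hk k) h1)

/-- The upper bound is the ultrametric inequality; the lower one holds because `w i` is itself a
term of the orthogonal combination `w i - c • w j`. -/
theorem map_sub_smul (h : IsFiltrationFunction (K := K) (Γ := Γ) ℓ)
    (hw : IsOrthogonalFamily K Γ ℓ w) {i j : ι} (hij : i ≠ j) {c : NovikovField K Γ}
    (hc : ℓ (c • w j) ≤ ℓ (w i)) : ℓ (w i - c • w j) = ℓ (w i) := by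
  classical
  refine le_antisymm ((h.sub_le _ _).trans (max_le le_rfl hc)) ?_
  have h1 := hw (Pi.single i 1 - Pi.single j c) i
  simpa [sub_smul, Finset.sum_sub_distrib, Pi.single_apply, hij] using h1

/-- Subtracting from each member a multiple, not larger than it, of a fixed member. -/
theorem sub_smul (h : IsFiltrationFunction (K := K) (Γ := Γ) ℓ)
    (hw : IsOrthogonalFamily K Γ ℓ w) (j : ι) (c : ι → NovikovField K Γ) (hj : c j = 0)
    (hc : ∀ i, ℓ (c i • w j) ≤ ℓ (w i)) :
    IsOrthogonalFamily K Γ ℓ (fun i => w i - c i • w j) := by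
  classical
  intro a
  set m := ℓ (∑ k, a k • (w k - c k • w j)) with hm
  -- Only the coefficient of `w j` changes, by `∑ i, a i * c i`.
  have hsum : ∑ k, a k • (w k - c k • w j) =
      ∑ k, (a - Pi.single j (∑ i, a i * c i) : ι → NovikovField K Γ) k • w k := by
    simp only [smul_sub, Finset.sum_sub_distrib, Pi.sub_apply, _root_.sub_smul]
    congr 1
    simp [Pi.single_apply, ite_smul, Finset.sum_smul, mul_smul]
  have hk : ∀ k, ℓ ((a - Pi.single j (∑ i, a i * c i) : ι → NovikovField K Γ) k • w k) ≤ m := fun k => by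
    rw [hm, hsum]
    exact hw _ k
  have hne : ∀ k, k ≠ j → ℓ (a k • w k) ≤ m := fun k hkj => by
    have := hk k
    rwa [Pi.sub_apply, Pi.single_eq_of_ne hkj, sub_zero] at this
  -- The term `i = j` drops out since `c j = 0`; for the others, `c i • w j` is no larger than `w
  -- i`, whose multiple by `a i` is already bounded.
  have hsm : ℓ ((∑ i, a i * c i) • w j) ≤ m := by
    rw [Finset.sum_smul]
    refine h.sum_le _ _ fun i _ => ?_
    by_cases hij : i = j
    · simp [hij, hj, h.map_zero]
    · refine le_trans ?_ (hne i hij)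
      rw [mul_smul, h.smul, h.smul (a i)]
      exact add_le_add_left (hc i) _
  intro k
  by_cases hkj : k = j
  · subst hkj
    have h1 := h.add_le ((a - Pi.single k (∑ i, a i * c i) : ι → NovikovField K Γ) k • w k) ((∑ i, a i * c i) • w k)
    rw [← add_smul, Pi.sub_apply, Pi.single_eq_same, sub_add_cancel] at h1
    simp only [hj, zero_smul, sub_zero]
    refine h1.trans (max_le ?_ hsm)
    simpa using hk k
  · rw [h.smul, hw.map_sub_smul h hkj (hc k), ← h.smul]
    exact hne k hkj

end IsOrthogonalFamily

end Orthogonal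

/-! ### Singular value decomposition -/

section SVD

variable {K : Type*} [Field K] {Γ : AddSubgroup ℝ} {C₁ C₀ : Type*}
  [AddCommGroup C₁] [Module (NovikovField K Γ) C₁]
  [AddCommGroup C₀] [Module (NovikovField K Γ) C₀]
  {ℓ₁ : C₁ → WithBot ℝ} {ℓ₀ : C₀ → WithBot ℝ}
  {ι₁ ι₀ : Type} [Fintype ι₁] [Fintype ι₀]

/-- Orthogonal bases with respect to which `d` maps the members indexed by `S` to distinct basis
vectors, and the other members to the span of the remaining basis vectors. -/
structure IsPartiallyDiagonal (ℓ₁ : C₁ → WithBot ℝ) (ℓ₀ : C₀ → WithBot ℝ)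
    (d : C₁ →ₗ[NovikovField K Γ] C₀) (y : Module.Basis ι₁ (NovikovField K Γ) C₁)
    (x : Module.Basis ι₀ (NovikovField K Γ) C₀) (S : Finset ι₁) (σ : ι₁ → ι₀) : Prop where
  orthogonal₁ : IsOrthogonalFamily K Γ ℓ₁ y
  orthogonal₀ : IsOrthogonalFamily K Γ ℓ₀ x
  injOn : Set.InjOn σ S
  map_mem : ∀ j ∈ S, d (y j) = x (σ j)
  repr_eq_zero : ∀ j ∉ S, ∀ k ∈ S, x.repr (d (y j)) (σ k) = 0

variable (h₁ : IsFiltrationFunction (K := K) (Γ := Γ) ℓ₁)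
  (h₀ : IsFiltrationFunction (K := K) (Γ := Γ) ℓ₀)
include h₁ h₀

/-- One step of elimination with full pivoting. The pivot maximizes `ℓ₀ (a i j • x i) - ℓ₁ (y j)`
over the undiagonalized columns. Maximality within its column makes `x i` dominant in `d (y j)`, so
`d (y j)` may replace `x i`; maximality within its row makes the multiples of `y j` needed to clear
that row small enough to keep the source basis orthogonal. -/
theorem IsPartiallyDiagonal.exists_insert {d : C₁ →ₗ[NovikovField K Γ] C₀}
    {y : Module.Basis ι₁ (NovikovField K Γ) C₁} {x : Module.Basis ι₀ (NovikovField K Γ) C₀}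
    {S : Finset ι₁} {σ : ι₁ → ι₀} (H : IsPartiallyDiagonal ℓ₁ ℓ₀ d y x S σ)
    (hS : ∃ j ∉ S, d (y j) ≠ 0) :
    ∃ (y' : Module.Basis ι₁ (NovikovField K Γ) C₁) (x' : Module.Basis ι₀ (NovikovField K Γ) C₀)
      (S' : Finset ι₁) (σ' : ι₁ → ι₀), IsPartiallyDiagonal ℓ₁ ℓ₀ d y' x' S' σ' ∧
        S.card < S'.card := by
  classical
  choose ry hry using fun j => h₁.exists_eq_coe (y.ne_zero j)
  choose rx hrx using fun i => h₀.exists_eq_coe (x.ne_zero i)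
  set a : ι₀ → ι₁ → NovikovField K Γ := fun i j => x.repr (d (y j)) i with ha
  have hda : ∀ j, d (y j) = ∑ k, a k j • x k := fun j => (x.sum_repr _).symm
  let P : Finset (ι₀ × ι₁) := Finset.univ.filter fun p => p.2 ∉ S ∧ a p.1 p.2 ≠ 0
  have hP : P.Nonempty := by
    obtain ⟨j, hjS, hj⟩ := hS
    obtain ⟨i, hi⟩ : ∃ i, a i j ≠ 0 := by
      by_contra! hcon
      exact hj (by rw [hda]; simp [hcon])
    exact ⟨(i, j), by simp [P, hjS, hi]⟩
  -- The default value `0` in `unbotD` is never used, as all entries in `P` are nonzero.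
  obtain ⟨⟨i, j⟩, hij, hmax⟩ := P.exists_max_image
    (fun p => rx p.1 + (novikovNegVal (a p.1 p.2)).unbotD 0 - ry p.2) hP
  obtain ⟨hjS, haij⟩ : j ∉ S ∧ a i j ≠ 0 := by simpa [P] using hij
  obtain ⟨v, hv⟩ := exists_novikovNegVal_eq haij
  have hmax' : ∀ i' j' (u : ℝ), j' ∉ S → novikovNegVal (a i' j') = (u : WithBot ℝ) →
      rx i' + u - ry j' ≤ rx i + v - ry j := by
    intro i' j' u hj' hu
    have h0 : a i' j' ≠ 0 := fun h => by simp [h, novikovNegVal_zero] at hu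
    have := hmax (i', j') (by simp [P, hj', h0])
    simpa [hu, hv] using this
  have hiS : ∀ k ∈ S, σ k ≠ i := by
    rintro k hk rfl
    exact haij (H.repr_eq_zero j hjS k hk)
  have haiS : ∀ k ∈ S, a i k = 0 := fun k hk => by
    simp [ha, H.map_mem k hk, hiS k hk]
  have hne : ∀ k ∈ S, k ≠ j := fun k hk hkj => hjS (hkj ▸ hk)
  -- the new basis of the target
  have hdom : ℓ₀ (d (y j)) = ℓ₀ (a i j • x i) := by
    refine le_antisymm ?_ ?_
    · rw [hda]
      refine h₀.sum_le _ _ fun k _ => ?_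
      by_cases hk : a k j = 0
      · simp [hk, h₀.map_zero]
      · obtain ⟨u, hu⟩ := exists_novikovNegVal_eq hk
        rw [h₀.smul, h₀.smul, hrx, hrx, hu, hv, ← WithBot.coe_add, ← WithBot.coe_add,
          WithBot.coe_le_coe]
        linarith [hmax' k j u hjS hu]
    · rw [hda]
      exact H.orthogonal₀ (fun k => a k j) i
  have hx' := H.orthogonal₀.update h₀ i (fun k => a k j) (hda j) hdom
  have hdy0 : d (y j) ≠ 0 := fun h => haij (by simp [ha, h])
  have : Nonempty ι₀ := ⟨i⟩
  have : Nonempty ι₁ := ⟨j⟩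
  obtain ⟨x', hxx⟩ := hx'.exists_basis h₀ (fun k => by
    by_cases hk : k = i
    · subst hk
      rwa [Function.update_self]
    · rw [Function.update_of_ne hk]
      exact x.ne_zero k) x
  -- the new basis of the source
  let m : ι₁ → NovikovField K Γ := fun k => if k = j then 0 else a i k / a i j
  have hm : ∀ k, ℓ₁ (m k • y j) ≤ ℓ₁ (y k) := by
    intro k
    by_cases hk : m k = 0
    · simp [hk, h₁.map_zero]
    · have hkj : k ≠ j := fun h => hk (by simp [m, h])
      have hmk : m k = a i k / a i j := by simp [m, hkj]
      have haik : a i k ≠ 0 := fun h => hk (by simp [hmk, h])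
      have hkS : k ∉ S := fun h => haik (haiS k h)
      obtain ⟨u, hu⟩ := exists_novikovNegVal_eq haik
      rw [h₁.smul, hmk, novikovNegVal_div hu hv, hry, hry, ← WithBot.coe_add, WithBot.coe_le_coe]
      linarith [hmax' i k u hkS hu]
  have hmj : m j = 0 := by simp [m]
  have hmS : ∀ k ∈ S, m k = 0 := fun k hk => by simp [m, haiS k hk]
  have hy' := H.orthogonal₁.sub_smul h₁ j m hmj hm
  obtain ⟨y', hyy⟩ := hy'.exists_basis h₁ (fun k => by
    by_cases hk : k = j
    · simpa [hk, hmj] using y.ne_zero j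
    · intro h
      have := H.orthogonal₁.map_sub_smul h₁ hk (hm k)
      rw [h, h₁.map_zero, hry] at this
      exact WithBot.bot_ne_coe this) y
  have hy'k : ∀ k, y' k = y k - m k • y j := fun k => congrFun hyy k
  -- The two target bases differ only in the `i`-th vector, so a vector not involving `x i` has the
  -- same coordinates in both.
  have hrepr : ∀ z, x.repr z i = 0 → ∀ k, x'.repr z k = x.repr z k := by
    intro z hz k
    have : z = ∑ k, x.repr z k • x' k := by
      conv_lhs => rw [← x.sum_repr z]
      refine Finset.sum_congr rfl fun k _ => ?_
      by_cases hk : k = i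
      · simp [hk, hz]
      · rw [hxx, Function.update_of_ne hk]
    conv_lhs => rw [this]
    rw [Module.Basis.repr_sum_self]
  refine ⟨y', x', insert j S, Function.update σ j i, ⟨hyy ▸ hy', hxx ▸ hx', ?_, ?_, ?_⟩, ?_⟩
  · intro k hk l hl hkl
    rw [Finset.mem_coe, Finset.mem_insert] at hk hl
    rcases hk with rfl | hk <;> rcases hl with rfl | hl
    · rfl
    · rw [Function.update_self, Function.update_of_ne (hne l hl)] at hkl
      exact absurd hkl.symm (hiS l hl)
    · rw [Function.update_self, Function.update_of_ne (hne k hk)] at hkl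
      exact absurd hkl (hiS k hk)
    · rw [Function.update_of_ne (hne l hl), Function.update_of_ne (hne k hk)] at hkl
      exact H.injOn hk hl hkl
  · intro k hk
    rw [Finset.mem_insert] at hk
    rcases hk with rfl | hk
    · rw [hy'k, hmj, hxx]
      simp
    · rw [hy'k, hmS k hk, hxx, Function.update_of_ne (hne k hk), Function.update_of_ne (hiS k hk)]
      simpa using H.map_mem k hk
  · intro k hk l hl
    rw [Finset.mem_insert, not_or] at hk
    have hmk : m k = a i k / a i j := by simp [m, hk.1]
    have hcoord : ∀ t, x.repr (d (y' k)) t = a t k - m k * a t j := fun t => by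
      rw [hy'k]
      simp [ha]
    have hi0 : x.repr (d (y' k)) i = 0 := by
      rw [hcoord, hmk, div_mul_cancel₀ _ haij, sub_self]
    rw [hrepr _ hi0]
    rw [Finset.mem_insert] at hl
    rcases hl with rfl | hl
    · rwa [Function.update_self]
    · rw [Function.update_of_ne (hne l hl), hcoord]
      have e1 : a (σ l) k = 0 := H.repr_eq_zero k hk.2 l hl
      have e2 : a (σ l) j = 0 := H.repr_eq_zero j hjS l hl
      rw [e1, e2, mul_zero, sub_zero]
  · rw [Finset.card_insert_of_notMem hjS]
    exact Nat.lt_succ_self _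

/-- Each elimination step enlarges `S`; `n` bounds the number of columns still outside it and serves
as the induction variable. -/
theorem IsPartiallyDiagonal.exists_diagonal {d : C₁ →ₗ[NovikovField K Γ] C₀} (n : ℕ)
    {y : Module.Basis ι₁ (NovikovField K Γ) C₁} {x : Module.Basis ι₀ (NovikovField K Γ) C₀}
    {S : Finset ι₁} {σ : ι₁ → ι₀} (H : IsPartiallyDiagonal ℓ₁ ℓ₀ d y x S σ)
    (hn : Fintype.card ι₁ ≤ S.card + n) :
    ∃ (y' : Module.Basis ι₁ (NovikovField K Γ) C₁) (x' : Module.Basis ι₀ (NovikovField K Γ) C₀)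
      (S' : Finset ι₁) (σ' : ι₁ → ι₀), IsPartiallyDiagonal ℓ₁ ℓ₀ d y' x' S' σ' ∧
        ∀ j ∉ S', d (y' j) = 0 := by
  induction n generalizing y x S σ with
  | zero =>
    have hS : S = Finset.univ := Finset.eq_univ_of_card S (le_antisymm (Finset.card_le_univ S) hn)
    exact ⟨y, x, S, σ, H, fun j hj => absurd (hS ▸ Finset.mem_univ j) hj⟩
  | succ n ih =>
    by_cases hS : ∃ j ∉ S, d (y j) ≠ 0
    · obtain ⟨y', x', S', σ', H', hlt⟩ := H.exists_insert h₁ h₀ hS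
      exact ih H' (by omega)
    · push Not at hS
      exact ⟨y, x, S, σ, H, hS⟩

/-- A linear map between spaces with orthogonal bases has a singular value decomposition. -/
theorem exists_singular_value_decomposition (d : C₁ →ₗ[NovikovField K Γ] C₀)
    {w₁ : Module.Basis ι₁ (NovikovField K Γ) C₁} {w₀ : Module.Basis ι₀ (NovikovField K Γ) C₀}
    (hw₁ : IsOrthogonalFamily K Γ ℓ₁ w₁) (hw₀ : IsOrthogonalFamily K Γ ℓ₀ w₀) :
    ∃ (ρ α β : Type) (_ : Fintype ρ) (_ : Fintype α) (_ : Fintype β)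
      (y : Module.Basis (ρ ⊕ α) (NovikovField K Γ) C₁)
      (x : Module.Basis (ρ ⊕ β) (NovikovField K Γ) C₀),
      IsOrthogonalFamily K Γ ℓ₁ y ∧ IsOrthogonalFamily K Γ ℓ₀ x ∧
        (∀ i, d (y (.inl i)) = x (.inl i)) ∧ ∀ j, d (y (.inr j)) = 0 := by
  classical
  -- The elimination starts with `S = ∅` and an arbitrary constant `σ`, which needs an element of
  -- `ι₀`. If there is none, the target is zero and all of `C₁` is kernel.
  rcases isEmpty_or_nonempty ι₀ with hι | ⟨⟨i₀⟩⟩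
  · have hsub : ∀ z : C₀, z = 0 := fun z => by rw [← w₀.sum_repr z]; simp
    refine ⟨Empty, ι₁, ι₀, inferInstance, inferInstance, inferInstance,
      w₁.reindex (Equiv.emptySum Empty ι₁).symm, w₀.reindex (Equiv.emptySum Empty ι₀).symm,
      ?_, ?_, fun i => i.elim, fun j => hsub _⟩
    · rw [Module.Basis.coe_reindex]
      exact hw₁.comp_equiv _
    · rw [Module.Basis.coe_reindex]
      exact hw₀.comp_equiv _
  obtain ⟨y, x, S, σ, H, hS⟩ := IsPartiallyDiagonal.exists_diagonal h₁ h₀ (d := d)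
    (Fintype.card ι₁) (y := w₁) (x := w₀) (S := ∅) (σ := fun _ => i₀)
    ⟨hw₁, hw₀, by simp, by simp, by simp⟩ (by simp)
  let e₁ : {j // j ∈ S} ⊕ {j // j ∉ S} ≃ ι₁ := Equiv.sumCompl _
  let f : {j // j ∈ S} ≃ {i // i ∈ S.image σ} := Equiv.ofBijective
    (fun j => ⟨σ j, Finset.mem_image_of_mem σ j.2⟩)
    ⟨fun j k hjk => Subtype.ext (H.injOn j.2 k.2 (congrArg Subtype.val hjk)), fun i => by
      obtain ⟨j, hj, hji⟩ := Finset.mem_image.1 i.2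
      exact ⟨⟨j, hj⟩, Subtype.ext hji⟩⟩
  let e₀ : {j // j ∈ S} ⊕ {i // i ∉ S.image σ} ≃ ι₀ :=
    (Equiv.sumCongr f (Equiv.refl _)).trans (Equiv.sumCompl _)
  refine ⟨{j // j ∈ S}, {j // j ∉ S}, {i // i ∉ S.image σ}, inferInstance, inferInstance,
    inferInstance, y.reindex e₁.symm, x.reindex e₀.symm, ?_, ?_, ?_, ?_⟩
  · rw [Module.Basis.coe_reindex]
    exact H.orthogonal₁.comp_equiv _
  · rw [Module.Basis.coe_reindex]
    exact H.orthogonal₀.comp_equiv _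
  · intro j
    have hf : (f j : ι₀) = σ j := rfl
    simpa [e₁, e₀, hf] using H.map_mem j j.2
  · intro j
    simpa [e₁] using hS j j.2

end SVD

/-! ### Presentations of modules over a local ring -/

section Presentation

variable {R M : Type*} [CommRing R] [AddCommGroup M] [Module R M] {ι κ : Type*}

/-- `p` exhibits `M` as the direct sum of the cyclic modules `R ⧸ I i`. -/
structure IsCyclicPresentation (p : (ι → R) →ₗ[R] M) (I : ι → Ideal R) : Prop where
  surjective : Function.Surjective p
  eq_zero_iff : ∀ r, p r = 0 ↔ ∀ i, r i ∈ I i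

/-- The generators of each presentation are expressed through the other by matrices `A` and `B`.
After multiplication by `c`, the summands with `c ∈ I i` disappear. Over the residue field the
remaining blocks satisfy `A' * B' = 1`, and the rank of `A'` is at most its number of columns. -/
theorem IsCyclicPresentation.card_le [IsLocalRing R] [Fintype ι] [Fintype κ]
    {I : ι → Ideal R} {J : κ → Ideal R} {p : (ι → R) →ₗ[R] M} {p' : (κ → R) →ₗ[R] M}
    (hp : IsCyclicPresentation p I) (hp' : IsCyclicPresentation p' J) (c : R) :
    Nat.card {j // c ∉ J j} ≤ Nat.card {i // c ∉ I i} := by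
  classical
  choose A hA using fun j => hp.surjective (p' (Pi.single j 1))
  choose B hB using fun i => hp'.surjective (p (Pi.single i 1))
  have key : ∀ j j', c * ((Pi.single j 1 : κ → R) j' - ∑ i : {i // c ∉ I i}, A j i * B i j') ∈ J j' := by
    intro j
    have h1 : c • p (A j) = ∑ i : {i // c ∉ I i}, (c * A j i) • p (Pi.single i.1 1) := by
      rw [← Finset.sum_subtype (Finset.univ.filter fun i => c ∉ I i) (by simp)
        (fun i => (c * A j i) • p (Pi.single i 1))]
      conv_lhs => rw [pi_eq_sum_univ' (A j), map_sum, Finset.smul_sum]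
      simp_rw [map_smul, smul_smul]
      symm
      refine Finset.sum_subset (Finset.subset_univ _) fun i _ hi => ?_
      have hci : c ∈ I i := by simpa using hi
      rw [mul_comm, mul_smul, ← map_smul p c, (hp.eq_zero_iff _).2, smul_zero]
      intro i'
      by_cases hii : i' = i
      · subst hii
        simpa using hci
      · simp [hii]
    have h2 : p' (c • (Pi.single j 1 - ∑ i : {i // c ∉ I i}, A j i • B i)) = 0 := by
      rw [map_smul, map_sub, smul_sub, ← hA, h1, map_sum, Finset.smul_sum, sub_eq_zero]
      exact Finset.sum_congr rfl fun i _ => by rw [map_smul, hB, smul_smul]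
    intro j'
    simpa using (hp'.eq_zero_iff _).1 h2 j'
  let k := IsLocalRing.ResidueField R
  let A' : Matrix {j // c ∉ J j} {i // c ∉ I i} k := Matrix.of fun j i => IsLocalRing.residue R (A j i)
  let B' : Matrix {i // c ∉ I i} {j // c ∉ J j} k := Matrix.of fun i j => IsLocalRing.residue R (B i j)
  have hAB : A' * B' = 1 := by
    ext j j'
    -- Were this entry of `1 - A * B` a unit, `key` would put `c` in `J j'`.
    have h1 : (Pi.single j.1 1 : κ → R) j' - ∑ i : {i // c ∉ I i}, A j i * B i j' ∈
        IsLocalRing.maximalIdeal R := by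
      rw [IsLocalRing.mem_maximalIdeal, mem_nonunits_iff]
      intro hu
      exact j'.2 ((Ideal.mul_unit_mem_iff_mem _ hu).1 (key j j'))
    rw [← IsLocalRing.residue_eq_zero_iff, map_sub, map_sum, sub_eq_zero] at h1
    simp only [map_mul] at h1
    rw [Matrix.mul_apply]
    simp only [A', B', Matrix.of_apply]
    rw [← h1, Pi.single_apply, Matrix.one_apply]
    by_cases h : j = j'
    · simp [h]
    · have h' : (j' : κ) ≠ j := fun e => h (Subtype.ext e.symm)
      simp [h, h']
  have h1 := Matrix.rank_mul_le_left A' B'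
  rw [hAB, Matrix.rank_one] at h1
  rw [Nat.card_eq_fintype_card, Nat.card_eq_fintype_card]
  exact h1.trans A'.rank_le_card_width

theorem IsCyclicPresentation.card_eq [IsLocalRing R] [Fintype ι] [Fintype κ]
    {I : ι → Ideal R} {J : κ → Ideal R} {p : (ι → R) →ₗ[R] M} {p' : (κ → R) →ₗ[R] M}
    (hp : IsCyclicPresentation p I) (hp' : IsCyclicPresentation p' J) (c : R) :
    Nat.card {j // c ∉ J j} = Nat.card {i // c ∉ I i} :=
  le_antisymm (hp.card_le hp' c) (hp'.card_le hp c)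

/-- The summands of a presentation with `I i = ⊤` may be dropped. -/
theorem IsCyclicPresentation.nonempty_equiv {q s : ℕ} {I : ι → Ideal R}
    {p : (ι → R) →ₗ[R] M} (hp : IsCyclicPresentation p I) (f : Fin q ⊕ Fin s → ι)
    (hf : Function.Injective f) (htop : ∀ i ∉ Set.range f, I i = ⊤)
    (hbot : ∀ k, I (f (.inl k)) = ⊥) {J : Fin s → Ideal R} (hJ : ∀ k, I (f (.inr k)) = J k) :
    Nonempty (M ≃ₗ[R] (Fin q → R) × ((k : Fin s) → R ⧸ J k)) := by
  let p' : (ι → R) →ₗ[R] (Fin q → R) × ((k : Fin s) → R ⧸ J k) :=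
    (LinearMap.pi fun k => LinearMap.proj (f (.inl k))).prod
      (LinearMap.pi fun k => (J k).mkQ ∘ₗ LinearMap.proj (f (.inr k)))
  have hsurj : Function.Surjective p' := by
    rintro ⟨u, v⟩
    -- Lifts are extended by zero to the indices outside the range of `f`.
    choose v' hv' using fun k => (J k).mkQ_surjective (v k)
    refine ⟨Function.extend f (Sum.elim u v') 0, ?_⟩
    refine Prod.ext (funext fun k => ?_) (funext fun k => ?_)
    · change Function.extend f (Sum.elim u v') 0 (f (.inl k)) = u k
      rw [hf.extend_apply, Sum.elim_inl]
    · change (J k).mkQ (Function.extend f (Sum.elim u v') 0 (f (.inr k))) = v k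
      rw [hf.extend_apply, Sum.elim_inr, hv']
  have hker : LinearMap.ker p = LinearMap.ker p' := by
    ext r
    have h' : p' r = 0 ↔ (∀ k, r (f (.inl k)) = 0) ∧ ∀ k, r (f (.inr k)) ∈ J k := by
      rw [Prod.ext_iff, funext_iff, funext_iff]
      refine and_congr Iff.rfl (forall_congr' fun k => ?_)
      exact Submodule.Quotient.mk_eq_zero (J k)
    rw [LinearMap.mem_ker, LinearMap.mem_ker, hp.eq_zero_iff, h']
    constructor
    · intro h
      refine ⟨fun k => ?_, fun k => hJ k ▸ h _⟩
      have := h (f (.inl k))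
      rwa [hbot, Ideal.mem_bot] at this
    · rintro ⟨ha, hb⟩ i
      by_cases hi : i ∈ Set.range f
      · obtain ⟨k | k, rfl⟩ := hi
        · simp [ha]
        · rw [hJ]
          exact hb k
      · simp [htop i hi]
  exact ⟨(p.quotKerEquivOfSurjective hp.surjective).symm ≪≫ₗ Submodule.quotEquivOfEq _ _ hker ≪≫ₗ
    p'.quotKerEquivOfSurjective hsurj⟩

theorem IsCyclicPresentation.of_equiv {q s : ℕ} {J : Fin s → Ideal R}
    (e : M ≃ₗ[R] (Fin q → R) × ((k : Fin s) → R ⧸ J k)) :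
    ∃ p : (Fin q ⊕ Fin s → R) →ₗ[R] M, IsCyclicPresentation p (Sum.elim (fun _ => ⊥) J) := by
  let p' : (Fin q ⊕ Fin s → R) →ₗ[R] (Fin q → R) × ((k : Fin s) → R ⧸ J k) :=
    (LinearMap.pi fun k => LinearMap.proj (.inl k)).prod
      (LinearMap.pi fun k => (J k).mkQ ∘ₗ LinearMap.proj (.inr k))
  refine ⟨e.symm.toLinearMap ∘ₗ p', ?_, ?_⟩
  · refine e.symm.surjective.comp ?_
    rintro ⟨u, v⟩
    choose v' hv' using fun k => (J k).mkQ_surjective (v k)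
    exact ⟨Sum.elim u v', Prod.ext rfl (funext hv')⟩
  · intro r
    have h' : p' r = 0 ↔ (∀ k, r (.inl k) = 0) ∧ ∀ k, r (.inr k) ∈ J k := by
      rw [Prod.ext_iff, funext_iff, funext_iff]
      refine and_congr Iff.rfl (forall_congr' fun k => ?_)
      exact Submodule.Quotient.mk_eq_zero (J k)
    rw [LinearMap.comp_apply, LinearEquiv.coe_coe, LinearEquiv.map_eq_zero_iff, h', Sum.forall]
    rfl

end Presentation

/-! ### The ring `Λ^{univ}_0` -/

section UnivNovikovZero

variable {K : Type*} [Field K]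

theorem novikovVal_mul {Γ : AddSubgroup ℝ} (a b : NovikovField K Γ) :
    novikovVal (a * b) = novikovVal a + novikovVal b :=
  HahnSeries.orderTop_mul _ _

theorem novikovVal_one {Γ : AddSubgroup ℝ} : novikovVal (1 : NovikovField K Γ) = 0 :=
  HahnSeries.orderTop_one

variable (K) in
/-- The element `T^r` of `Λ^{univ}`. -/
def univNovikovPow (r : ℝ) : UnivNovikov K :=
  ⟨HahnSeries.single r 1, IsNovikov.single (AddSubgroup.mem_top _) 1⟩

theorem novikovVal_univNovikovPow (r : ℝ) : novikovVal (univNovikovPow K r) = r :=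
  HahnSeries.orderTop_single one_ne_zero

theorem univNovikovPow_add (r s : ℝ) :
    univNovikovPow K (r + s) = univNovikovPow K r * univNovikovPow K s :=
  Subtype.ext (by
    change HahnSeries.single (r + s) 1 = HahnSeries.single r 1 * HahnSeries.single s 1
    rw [HahnSeries.single_mul_single, one_mul])

theorem univNovikovPow_zero : univNovikovPow K 0 = 1 := rfl

theorem univNovikovPow_mul_neg (r : ℝ) : univNovikovPow K r * univNovikovPow K (-r) = 1 := by
  rw [← univNovikovPow_add, add_neg_cancel, univNovikovPow_zero]

theorem univNovikovPow_neg_mul (r : ℝ) : univNovikovPow K (-r) * univNovikovPow K r = 1 := by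
  rw [mul_comm, univNovikovPow_mul_neg]

theorem mem_univNovikovZero {a : UnivNovikov K} : a ∈ univNovikovZero K ↔ 0 ≤ novikovVal a :=
  Iff.rfl

theorem univNovikovZero_isUnit_iff {a : univNovikovZero K} :
    IsUnit a ↔ novikovVal (a : UnivNovikov K) = 0 := by
  constructor
  · intro h
    obtain ⟨b, hb⟩ := h.exists_right_inv
    have h1 := novikovVal_mul (a : UnivNovikov K) b
    rw [show (a : UnivNovikov K) * b = 1 from congrArg Subtype.val hb, novikovVal_one] at h1
    exact (((add_eq_zero_iff_of_nonneg a.2 b.2).1 h1.symm)).1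
  · intro h
    have ha : (a : UnivNovikov K) ≠ 0 := by
      intro h0
      rw [h0, show novikovVal (0 : UnivNovikov K) = ⊤ from HahnSeries.orderTop_zero] at h
      exact WithTop.top_ne_zero h
    have h1 := novikovVal_mul (a : UnivNovikov K) (a : UnivNovikov K)⁻¹
    rw [mul_inv_cancel₀ ha, novikovVal_one, h, zero_add] at h1
    exact IsUnit.of_mul_eq_one (⟨(a : UnivNovikov K)⁻¹, h1.le⟩ : univNovikovZero K)
      (Subtype.ext (mul_inv_cancel₀ ha))

instance : IsLocalRing (univNovikovZero K) :=
  IsLocalRing.of_nonunits_add fun a b ha hb => by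
    rw [mem_nonunits_iff, univNovikovZero_isUnit_iff] at ha hb ⊢
    have ha' := lt_of_le_of_ne a.2 (Ne.symm ha)
    have hb' := lt_of_le_of_ne b.2 (Ne.symm hb)
    have h : min (novikovVal (a : UnivNovikov K)) (novikovVal (b : UnivNovikov K)) ≤
        novikovVal ((a + b : univNovikovZero K) : UnivNovikov K) :=
      HahnSeries.min_orderTop_le_orderTop_add
    exact ((lt_min ha' hb').trans_le h).ne'

theorem univNovikovT_mem_span_iff {a b : ℝ≥0} :
    univNovikovT K a ∈ Ideal.span {univNovikovT K b} ↔ b ≤ a := by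
  rw [Ideal.mem_span_singleton']
  constructor
  · rintro ⟨c, hc⟩
    have h1 := novikovVal_mul (c : UnivNovikov K) (univNovikovPow K b)
    rw [show (c : UnivNovikov K) * univNovikovPow K b = univNovikovPow K a from
      congrArg Subtype.val hc, novikovVal_univNovikovPow, novikovVal_univNovikovPow] at h1
    have h2 : ((b : ℝ) : WithTop ℝ) ≤ (a : ℝ) := by
      rw [h1]
      exact le_add_of_nonneg_left c.2
    exact_mod_cast h2
  · intro h
    refine ⟨univNovikovT K (a - b), Subtype.ext ?_⟩
    change univNovikovPow K ((a - b : ℝ≥0) : ℝ) * univNovikovPow K b = univNovikovPow K a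
    rw [← univNovikovPow_add, NNReal.coe_sub h, sub_add_cancel]

theorem univNovikovT_ne_zero (a : ℝ≥0) : univNovikovT K a ≠ 0 := fun h => by
  have h1 : univNovikovPow K a = 0 := congrArg Subtype.val h
  have h2 := univNovikovPow_mul_neg (K := K) a
  rw [h1, zero_mul] at h2
  exact zero_ne_one h2

theorem univNovikovT_zero : univNovikovT K 0 = 1 := rfl

end UnivNovikovZero

/-! ### Coordinates on the filtered part -/

section Coordinates

variable {K : Type*} [Field K] {Γ : AddSubgroup ℝ} {C : Type*} [AddCommGroup C]
  [Module (NovikovField K Γ) C] {ℓ : C → WithBot ℝ} {ι κ : Type*}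

theorem add_novikovNegVal_sum_le (s : Finset ι) (f : ι → NovikovField K Γ) {b m : WithBot ℝ}
    (hm : ∀ i ∈ s, b + novikovNegVal (f i) ≤ m) : b + novikovNegVal (∑ i ∈ s, f i) ≤ m := by
  classical
  induction s using Finset.induction_on with
  | empty => simp [novikovNegVal_zero]
  | insert i s hi ih =>
    rw [Finset.sum_insert hi]
    refine (add_le_add_right (novikovNegVal_add_le _ _) _).trans ?_
    rw [← max_add_add_left]
    exact max_le (hm i (Finset.mem_insert_self i s))
      (ih fun j hj => hm j (Finset.mem_insert_of_mem hj))

/-- The basis `w_i ⊗ 1` of `C'`, for an arbitrary index type. -/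
def CoeffExt.extendBasis (w : Module.Basis ι (NovikovField K Γ) C) :
    Module.Basis ι (UnivNovikov K) (CoeffExt K Γ C) :=
  w.baseChange (UnivNovikov K)

theorem CoeffExt.extendBasis_apply (w : Module.Basis ι (NovikovField K Γ) C) (i : ι) :
    CoeffExt.extendBasis w i = CoeffExt.of K Γ (w i) :=
  Module.Basis.baseChange_apply (UnivNovikov K) w i

theorem CoeffExt.extendBasis_repr_of (w : Module.Basis ι (NovikovField K Γ) C) (x : C) (i : ι) :
    (CoeffExt.extendBasis w).repr (CoeffExt.of K Γ x) i =
      algebraMap (NovikovField K Γ) (UnivNovikov K) (w.repr x i) :=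
  (Module.Basis.baseChange_repr_tmul (UnivNovikov K) w 1 x i).trans
    (Algebra.algebraMap_eq_smul_one _).symm

/-- Orthogonality of `x` bounds each component of `z j` along `x i` by `ℓ (z j)`, and this estimate
survives extension of scalars. Used in both directions, it shows that the filtered part does not
depend on the orthogonal basis defining it. -/
theorem extFiltration_coord_le [Fintype ι] [Fintype κ]
    (h : IsFiltrationFunction (K := K) (Γ := Γ) ℓ) {x : Module.Basis ι (NovikovField K Γ) C}
    {z : Module.Basis κ (NovikovField K Γ) C} (hx : IsOrthogonalFamily K Γ ℓ x)
    {c : CoeffExt K Γ C} {m : WithBot ℝ}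
    (hc : ∀ j, ℓ (z j) + novikovNegVal ((CoeffExt.extendBasis z).repr c j) ≤ m) (i : ι) :
    ℓ (x i) + novikovNegVal ((CoeffExt.extendBasis x).repr c i) ≤ m := by
  have hrepr : (CoeffExt.extendBasis x).repr c i = ∑ j, (CoeffExt.extendBasis z).repr c j *
      algebraMap (NovikovField K Γ) (UnivNovikov K) (x.repr (z j) i) := by
    conv_lhs => rw [← (CoeffExt.extendBasis z).sum_repr c]
    simp [CoeffExt.extendBasis_apply, CoeffExt.extendBasis_repr_of]
  rw [hrepr]
  refine add_novikovNegVal_sum_le _ _ fun j _ => le_trans ?_ (hc j)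
  rw [novikovNegVal_mul, novikovNegVal_algebraMap, add_comm (novikovNegVal _), ← add_assoc,
    ← h.smul]
  refine add_le_add_left ?_ _
  conv_rhs => rw [← x.sum_repr (z j)]
  exact hx _ i

theorem mem_filteredPart_iff [Fintype ι] (h : IsFiltrationFunction (K := K) (Γ := Γ) ℓ) {n : ℕ}
    {w : Module.Basis (Fin n) (NovikovField K Γ) C} (hw : IsOrthogonalFamily K Γ ℓ w)
    {x : Module.Basis ι (NovikovField K Γ) C} (hx : IsOrthogonalFamily K Γ ℓ x)
    {c : CoeffExt K Γ C} : c ∈ filteredPart ℓ w ↔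
      ∀ i, ℓ (x i) + novikovNegVal ((CoeffExt.extendBasis x).repr c i) ≤ 0 := by
  have h1 : c ∈ filteredPart ℓ w ↔
      ∀ i, ℓ (w i) + novikovNegVal ((CoeffExt.extendBasis w).repr c i) ≤ 0 :=
    (Finset.sup_le_iff (s := Finset.univ)
      (f := fun i => ℓ (w i) + novikovNegVal ((CoeffExt.basis w).repr c i))).trans
      ⟨fun h i => h i (Finset.mem_univ i), fun h i _ => h i⟩
  rw [h1]
  exact ⟨extFiltration_coord_le h hx, extFiltration_coord_le h hw⟩

theorem coe_add_novikovNegVal_le_zero_iff {r : ℝ} {a : UnivNovikov K} :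
    (r : WithBot ℝ) + novikovNegVal a ≤ 0 ↔ univNovikovPow K (-r) * a ∈ univNovikovZero K := by
  rw [mem_univNovikovZero, novikovVal_mul, novikovVal_univNovikovPow]
  unfold novikovNegVal
  cases novikovVal a with
  | top => simp
  | coe v =>
    change ((r + -v : ℝ) : WithBot ℝ) ≤ ((0 : ℝ) : WithBot ℝ) ↔
      ((0 : ℝ) : WithTop ℝ) ≤ ((-r + v : ℝ) : WithTop ℝ)
    rw [WithBot.coe_le_coe, WithTop.coe_le_coe]
    constructor <;> intro h <;> linarith

/-- The filtered part is free on the elements `T^{ℓ x_i} x_i` for any orthogonal basis `x`. -/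
theorem exists_filteredPart_equiv [Fintype ι] (h : IsFiltrationFunction (K := K) (Γ := Γ) ℓ)
    {n : ℕ} {w : Module.Basis (Fin n) (NovikovField K Γ) C} (hw : IsOrthogonalFamily K Γ ℓ w)
    {x : Module.Basis ι (NovikovField K Γ) C} (hx : IsOrthogonalFamily K Γ ℓ x)
    {r : ι → ℝ} (hr : ∀ i, ℓ (x i) = (r i : WithBot ℝ)) :
    ∃ θ : filteredPart ℓ w ≃ₗ[univNovikovZero K] (ι → univNovikovZero K), ∀ c i,
      (θ c i : UnivNovikov K) =
        univNovikovPow K (-r i) * (CoeffExt.extendBasis x).repr (c : CoeffExt K Γ C) i := by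
  have hmem : ∀ c : CoeffExt K Γ C, c ∈ filteredPart ℓ w ↔ ∀ i,
      univNovikovPow K (-r i) * (CoeffExt.extendBasis x).repr c i ∈ univNovikovZero K := by
    intro c
    rw [mem_filteredPart_iff h hw hx]
    exact forall_congr' fun i => by rw [hr, coe_add_novikovNegVal_le_zero_iff]
  let f : filteredPart ℓ w →ₗ[univNovikovZero K] (ι → univNovikovZero K) :=
    { toFun := fun c i => ⟨_, (hmem c).1 c.2 i⟩
      map_add' := fun c d => funext fun i => Subtype.ext (by
        change _ * (CoeffExt.extendBasis x).repr ((c : CoeffExt K Γ C) + d) i = _ * _ + _ * _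
        rw [map_add, Finsupp.add_apply, mul_add])
      map_smul' := fun a c => funext fun i => Subtype.ext (by
        change _ * (CoeffExt.extendBasis x).repr ((a : UnivNovikov K) • (c : CoeffExt K Γ C)) i =
          (a : UnivNovikov K) * (_ * _)
        rw [map_smul, Finsupp.smul_apply, smul_eq_mul, mul_left_comm]) }
  have hf : ∀ c i, (f c i : UnivNovikov K) =
      univNovikovPow K (-r i) * (CoeffExt.extendBasis x).repr (c : CoeffExt K Γ C) i :=
    fun _ _ => rfl
  refine ⟨LinearEquiv.ofBijective f ⟨?_, ?_⟩, hf⟩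
  · intro c d hcd
    refine Subtype.ext ((CoeffExt.extendBasis x).ext_elem fun i => ?_)
    have h1 := congrArg (fun u => univNovikovPow K (r i) * ((u i : univNovikovZero K) : UnivNovikov K)) hcd
    simpa only [hf, ← mul_assoc, univNovikovPow_mul_neg, one_mul] using h1
  · intro u
    let c : CoeffExt K Γ C :=
      (CoeffExt.extendBasis x).equivFun.symm fun i => univNovikovPow K (r i) * u i
    have hc : ∀ i, univNovikovPow K (-r i) * (CoeffExt.extendBasis x).repr c i = u i := fun i => by
      rw [← Module.Basis.equivFun_apply, LinearEquiv.apply_symm_apply, ← mul_assoc,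
        univNovikovPow_neg_mul, one_mul]
    refine ⟨⟨c, (hmem c).2 fun i => ?_⟩, funext fun i => Subtype.ext (hc i)⟩
    rw [hc]
    exact (u i).2

end Coordinates

/-! ### Boundary depths and torsion exponents in terms of singular values -/

section Main

variable {K : Type*} [Field K] {Γ : AddSubgroup ℝ} {C₁ C₀ : Type*}
  [AddCommGroup C₁] [Module (NovikovField K Γ) C₁]
  [AddCommGroup C₀] [Module (NovikovField K Γ) C₀] (X : TwoTermFloerComplex K Γ C₁ C₀)
  {ρ α β : Type} [Fintype ρ] [Fintype α] [Fintype β]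

namespace TwoTermFloerComplex

/-- A singular value decomposition of `∂` with singular values `g`. -/
structure IsSingularValueDecomposition (y : Module.Basis (ρ ⊕ α) (NovikovField K Γ) C₁)
    (x : Module.Basis (ρ ⊕ β) (NovikovField K Γ) C₀) (g : ρ → ℝ≥0) : Prop where
  orthogonal₁ : IsOrthogonalFamily K Γ X.ℓ₁ y
  orthogonal₀ : IsOrthogonalFamily K Γ X.ℓ₀ x
  map_inl : ∀ i, X.d (y (.inl i)) = x (.inl i)
  map_inr : ∀ j, X.d (y (.inr j)) = 0
  gap : ∀ i, X.ℓ₁ (y (.inl i)) = X.ℓ₀ (x (.inl i)) + ((g i : ℝ) : WithBot ℝ)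

theorem exists_isSingularValueDecomposition {n₁ n₀ : ℕ}
    {w₁ : Module.Basis (Fin n₁) (NovikovField K Γ) C₁}
    {w₀ : Module.Basis (Fin n₀) (NovikovField K Γ) C₀}
    (hw₁ : IsOrthogonal (K := K) (Γ := Γ) X.ℓ₁ w₁)
    (hw₀ : IsOrthogonal (K := K) (Γ := Γ) X.ℓ₀ w₀) :
    ∃ (ρ α β : Type) (_ : Fintype ρ) (_ : Fintype α) (_ : Fintype β)
      (y : Module.Basis (ρ ⊕ α) (NovikovField K Γ) C₁)
      (x : Module.Basis (ρ ⊕ β) (NovikovField K Γ) C₀) (g : ρ → ℝ≥0),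
      X.IsSingularValueDecomposition y x g := by
  have h₁ := X.orthogonalizable₁.toIsFiltrationFunction
  have h₀ := X.orthogonalizable₀.toIsFiltrationFunction
  obtain ⟨ρ, α, β, i₁, i₂, i₃, y, x, hy, hx, hinl, hinr⟩ := exists_singular_value_decomposition
    h₁ h₀ X.d hw₁.isOrthogonalFamily hw₀.isOrthogonalFamily
  choose r₁ hr₁ using fun i : ρ => h₁.exists_eq_coe (y.ne_zero (.inl i))
  choose r₀ hr₀ using fun i : ρ => h₀.exists_eq_coe (x.ne_zero (.inl i))
  have hle : ∀ i, r₀ i ≤ r₁ i := fun i => by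
    rw [← WithBot.coe_le_coe, ← hr₀, ← hr₁, ← hinl]
    exact X.d_le _
  refine ⟨ρ, α, β, i₁, i₂, i₃, y, x, fun i => ⟨r₁ i - r₀ i, sub_nonneg.2 (hle i)⟩,
    hy, hx, hinl, hinr, fun i => ?_⟩
  rw [hr₀, hr₁, ← WithBot.coe_add, WithBot.coe_inj]
  exact (add_sub_cancel _ _).symm

namespace IsSingularValueDecomposition

variable {X} {y : Module.Basis (ρ ⊕ α) (NovikovField K Γ) C₁}
  {x : Module.Basis (ρ ⊕ β) (NovikovField K Γ) C₀} {g : ρ → ℝ≥0}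
  (H : X.IsSingularValueDecomposition y x g)
include H

theorem repr_map_inl (u : C₁) (i : ρ) : x.repr (X.d u) (.inl i) = y.repr u (.inl i) := by
  have h : x.coord (.inl i) ∘ₗ X.d = y.coord (.inl i) := by
    classical
    refine y.ext fun k => ?_
    rcases k with k | k
    · simp [H.map_inl, Finsupp.single_apply]
    · simp [H.map_inr]
  exact LinearMap.congr_fun h u

theorem repr_map_inr (u : C₁) (j : β) : x.repr (X.d u) (.inr j) = 0 := by
  have h : x.coord (.inr j) ∘ₗ X.d = 0 := by
    refine y.ext fun k => ?_
    rcases k with k | k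
    · simp [H.map_inl]
    · simp [H.map_inr]
  exact LinearMap.congr_fun h u

theorem extend_repr_map_inl (u : CoeffExt K Γ C₁) (i : ρ) :
    (CoeffExt.extendBasis x).repr (CoeffExt.map X.d u) (.inl i) =
      (CoeffExt.extendBasis y).repr u (.inl i) := by
  have h : (CoeffExt.extendBasis x).coord (.inl i) ∘ₗ CoeffExt.map X.d =
      (CoeffExt.extendBasis y).coord (.inl i) := by
    refine (CoeffExt.extendBasis y).ext fun k => ?_
    rw [LinearMap.comp_apply, CoeffExt.extendBasis_apply, CoeffExt.map_of, Module.Basis.coord_apply,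
      Module.Basis.coord_apply, CoeffExt.extendBasis_repr_of, CoeffExt.extendBasis_repr_of,
      H.repr_map_inl]
  exact LinearMap.congr_fun h u

theorem extend_repr_map_inr (u : CoeffExt K Γ C₁) (j : β) :
    (CoeffExt.extendBasis x).repr (CoeffExt.map X.d u) (.inr j) = 0 := by
  have h : (CoeffExt.extendBasis x).coord (.inr j) ∘ₗ CoeffExt.map X.d = 0 := by
    refine (CoeffExt.extendBasis y).ext fun k => ?_
    rw [LinearMap.comp_apply, CoeffExt.extendBasis_apply, CoeffExt.map_of, Module.Basis.coord_apply,
      CoeffExt.extendBasis_repr_of, H.repr_map_inr, map_zero, LinearMap.zero_apply]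
  exact LinearMap.congr_fun h u

/-- In the bases `T^{ℓ y_i} y_i` and `T^{ℓ x_i} x_i` of the filtered parts, the boundary is
multiplication by `T^{g i}` on the `ρ`-coordinates and zero on the `β`-coordinates of the target, so
the cokernel splits coordinatewise. -/
theorem exists_presentation {n₁ n₀ : ℕ}
    {w₁ : Module.Basis (Fin n₁) (NovikovField K Γ) C₁}
    {w₀ : Module.Basis (Fin n₀) (NovikovField K Γ) C₀}
    (hw₁ : IsOrthogonal (K := K) (Γ := Γ) X.ℓ₁ w₁)
    (hw₀ : IsOrthogonal (K := K) (Γ := Γ) X.ℓ₀ w₀) :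
    ∃ p : (ρ ⊕ β → univNovikovZero K) →ₗ[univNovikovZero K]
        (filteredPart X.ℓ₀ w₀ ⧸ LinearMap.range (X.filteredBoundary w₁ hw₀)),
      IsCyclicPresentation p
        (Sum.elim (fun i => Ideal.span {univNovikovT K (g i)}) fun _ => ⊥) := by
  have h₁ := X.orthogonalizable₁.toIsFiltrationFunction
  have h₀ := X.orthogonalizable₀.toIsFiltrationFunction
  choose r₁ hr₁ using fun i => h₁.exists_eq_coe (y.ne_zero i)
  choose r₀ hr₀ using fun i => h₀.exists_eq_coe (x.ne_zero i)
  have hg : ∀ i, r₁ (.inl i) = r₀ (.inl i) + g i := fun i => by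
    rw [← WithBot.coe_inj, WithBot.coe_add, ← hr₀, ← hr₁, H.gap]
  obtain ⟨θ₁, hθ₁⟩ := exists_filteredPart_equiv h₁ hw₁.isOrthogonalFamily H.orthogonal₁ hr₁
  obtain ⟨θ₀, hθ₀⟩ := exists_filteredPart_equiv h₀ hw₀.isOrthogonalFamily H.orthogonal₀ hr₀
  have hinl : ∀ c i, θ₀ (X.filteredBoundary w₁ hw₀ c) (.inl i) =
      θ₁ c (.inl i) * univNovikovT K (g i) := fun c i => Subtype.ext (by
    rw [hθ₀]
    change _ * (CoeffExt.extendBasis x).repr (CoeffExt.map X.d (c : CoeffExt K Γ C₁)) (.inl i) =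
      (θ₁ c (.inl i) : UnivNovikov K) * univNovikovPow K (g i)
    rw [hθ₁, H.extend_repr_map_inl, mul_right_comm, ← univNovikovPow_add, hg]
    congr 2
    ring)
  have hinr : ∀ c j, θ₀ (X.filteredBoundary w₁ hw₀ c) (.inr j) = 0 := fun c j => Subtype.ext (by
    rw [hθ₀]
    change _ * (CoeffExt.extendBasis x).repr (CoeffExt.map X.d (c : CoeffExt K Γ C₁)) (.inr j) = 0
    rw [H.extend_repr_map_inr, mul_zero])
  refine ⟨(LinearMap.range (X.filteredBoundary w₁ hw₀)).mkQ ∘ₗ θ₀.symm.toLinearMap,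
    (Submodule.mkQ_surjective _).comp θ₀.symm.surjective, fun r => ?_⟩
  rw [LinearMap.comp_apply, Submodule.mkQ_apply, Submodule.Quotient.mk_eq_zero, Sum.forall]
  simp only [Sum.elim_inl, Sum.elim_inr, Ideal.mem_bot, Ideal.mem_span_singleton']
  constructor
  · rintro ⟨c, hc⟩
    have hr : r = θ₀ (X.filteredBoundary w₁ hw₀ c) := by
      rw [hc]
      exact (θ₀.apply_symm_apply r).symm
    exact ⟨fun i => ⟨θ₁ c (.inl i), by rw [hr, hinl]⟩, fun j => by rw [hr, hinr]⟩
  · rintro ⟨ha, hb⟩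
    choose a ha using ha
    refine ⟨θ₁.symm (Sum.elim a 0), θ₀.injective ?_⟩
    refine Eq.trans ?_ (θ₀.apply_symm_apply r).symm
    funext k
    rcases k with i | j
    · rw [hinl, θ₁.apply_symm_apply, Sum.elim_inl, ha]
    · rw [hinr, hb]

theorem exists_isTorsionDecomposition {n₁ n₀ : ℕ}
    {w₁ : Module.Basis (Fin n₁) (NovikovField K Γ) C₁}
    {w₀ : Module.Basis (Fin n₀) (NovikovField K Γ) C₀}
    (hw₁ : IsOrthogonal (K := K) (Γ := Γ) X.ℓ₁ w₁)
    (hw₀ : IsOrthogonal (K := K) (Γ := Γ) X.ℓ₀ w₀) :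
    ∃ (q s : ℕ) (lam : Fin s → ℝ≥0), X.IsTorsionDecomposition w₁ hw₀ q s lam := by
  classical
  obtain ⟨p, hp⟩ := H.exists_presentation hw₁ hw₀
  let e := Fintype.equivFin {i // 0 < g i}
  let lam' : Fin (Fintype.card {i // 0 < g i}) → ℝ≥0 := fun k => g (e.symm k)
  -- `Tuple.sort` produces increasing order; precomposing with `Fin.revPerm` makes it decreasing.
  let τ : Fin (Fintype.card {i // 0 < g i}) ≃ {i // 0 < g i} :=
    (Fin.revPerm.trans (Tuple.sort lam')).trans e.symm
  let f : Fin (Fintype.card β) ⊕ Fin (Fintype.card {i // 0 < g i}) → ρ ⊕ β :=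
    Sum.elim (fun k => .inr ((Fintype.equivFin β).symm k)) fun k => .inl (τ k)
  refine ⟨Fintype.card β, _, fun k => g (τ k), ?_, fun k => (τ k).2,
    hp.nonempty_equiv f ?_ ?_ (fun _ => rfl) fun _ => rfl⟩
  · intro k l hkl
    exact Tuple.monotone_sort lam' (Fin.rev_le_rev.2 hkl)
  · rintro (k | k) (l | l) hkl
    · simpa [f] using hkl
    · simp [f] at hkl
    · simp [f] at hkl
    · have : (τ k : ρ) = τ l := by simpa [f] using hkl
      rw [τ.injective (Subtype.ext this)]
  · rintro (i | j) hi
    · have hgi : g i = 0 := by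
        by_contra hne
        exact hi ⟨.inr (τ.symm ⟨i, pos_iff_ne_zero.2 hne⟩), by simp [f]⟩
      rw [Sum.elim_inl, hgi, univNovikovT_zero, Ideal.span_singleton_one]
    · exact absurd ⟨.inl (Fintype.equivFin β j), by simp [f]⟩ hi

theorem card_gap_eq {n₁ n₀ : ℕ}
    {w₁ : Module.Basis (Fin n₁) (NovikovField K Γ) C₁}
    {w₀ : Module.Basis (Fin n₀) (NovikovField K Γ) C₀}
    (hw₁ : IsOrthogonal (K := K) (Γ := Γ) X.ℓ₁ w₁)
    (hw₀ : IsOrthogonal (K := K) (Γ := Γ) X.ℓ₀ w₀) {q s : ℕ} {lam : Fin s → ℝ≥0}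
    (hlam : X.IsTorsionDecomposition w₁ hw₀ q s lam) (t : ℝ≥0) :
    Nat.card {k // t < lam k} = Nat.card {i // t < g i} := by
  classical
  obtain ⟨p, hp⟩ := H.exists_presentation hw₁ hw₀
  obtain ⟨-, -, ⟨e⟩⟩ := hlam
  obtain ⟨p', hp'⟩ := IsCyclicPresentation.of_equiv e
  -- `T^t` kills `Λ₀/T^λ` exactly when `λ ≤ t`, and kills no free summand.
  have hcard : ∀ t : ℝ≥0, q + Nat.card {k // t < lam k} = Nat.card {i // t < g i} + Fintype.card β := by
    intro t
    have h := hp.card_eq hp' (univNovikovT K t)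
    simp only [Nat.card_eq_fintype_card, Fintype.card_subtype, Finset.card_filter,
      Fintype.sum_sum_type, Sum.elim_inl, Sum.elim_inr, univNovikovT_mem_span_iff, not_le,
      Ideal.mem_bot, univNovikovT_ne_zero, not_false_eq_true, if_true, Finset.sum_const,
      Finset.card_univ, Fintype.card_fin, smul_eq_mul, mul_one] at h ⊢
    exact h
  -- Above every exponent on both sides only free summands are counted, which forces `q` to equal
  -- the cardinality of `β`.
  let t₀ : ℝ≥0 := Finset.univ.sup lam ⊔ Finset.univ.sup g
  have h1 : Nat.card {k // t₀ < lam k} = 0 := by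
    have : IsEmpty {k // t₀ < lam k} := ⟨fun k => k.2.not_ge
      ((Finset.le_sup (f := lam) (Finset.mem_univ k.1)).trans le_sup_left)⟩
    exact Nat.card_of_isEmpty
  have h2 : Nat.card {i // t₀ < g i} = 0 := by
    have : IsEmpty {i // t₀ < g i} := ⟨fun k => k.2.not_ge
      ((Finset.le_sup (f := g) (Finset.mem_univ k.1)).trans le_sup_right)⟩
    exact Nat.card_of_isEmpty
  have h3 := hcard t₀
  have h4 := hcard t
  omega

/-- A `δ`-robust subspace of dimension `k` exists iff at least `k` singular values exceed `δ`. -/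
theorem exists_isRobustSubspace_iff (δ : ℝ≥0) (k : ℕ) :
    (∃ V : Submodule (NovikovField K Γ) C₀, V ≤ LinearMap.range X.d ∧
      X.IsRobustSubspace δ V ∧ Module.finrank (NovikovField K Γ) V = k) ↔
    k ≤ Nat.card {i // δ < g i} := by
  classical
  have h₁ := X.orthogonalizable₁.toIsFiltrationFunction
  have h₀ := X.orthogonalizable₀.toIsFiltrationFunction
  rw [Nat.card_eq_fintype_card]
  constructor
  · rintro ⟨V, hV, hrob, rfl⟩
    have : Module.Finite (NovikovField K Γ) C₀ := Module.Finite.of_basis x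
    -- If `V` had dimension larger than the number of gaps exceeding `δ`, projecting to those
    -- coordinates would kill some nonzero `z` in `V`.
    let π : V →ₗ[NovikovField K Γ] ({i // δ < g i} → NovikovField K Γ) :=
      (LinearMap.pi fun i : {i // δ < g i} => x.coord (.inl i)) ∘ₗ V.subtype
    by_contra! hlt
    have hker : LinearMap.ker π ≠ ⊥ := LinearMap.ker_ne_bot_of_finrank_lt (by
      rwa [Module.finrank_fintype_fun_eq_card])
    obtain ⟨⟨z, hzV⟩, hz, hz0⟩ := Submodule.exists_mem_ne_zero_of_ne_bot hker
    have hz0' : z ≠ 0 := fun h => hz0 (Subtype.ext h)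
    have hbig : ∀ i, δ < g i → x.repr z (.inl i) = 0 := fun i hi =>
      congrFun (LinearMap.mem_ker.1 hz) ⟨i, hi⟩
    obtain ⟨v, rfl⟩ := hV hzV
    -- The primitive with no component in the kernel directions. Only gaps at most `δ` contribute,
    -- so its level exceeds that of `X.d v` by at most `δ`, against robustness.
    let u : C₁ := ∑ i, x.repr (X.d v) (.inl i) • y (.inl i)
    have hu : X.d u = X.d v := by
      have h := x.sum_repr (X.d v)
      rw [Fintype.sum_sum_type] at h
      simp only [H.repr_map_inr, zero_smul, Finset.sum_const_zero, add_zero] at h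
      simpa only [u, map_sum, map_smul, H.map_inl] using h
    refine (hrob _ hzV hz0' u hu).not_ge (h₁.sum_le _ _ fun i _ => ?_)
    rcases lt_or_ge δ (g i) with hi | hi
    · simp [hbig i hi, h₁.map_zero]
    · rw [h₁.smul, H.gap, add_right_comm, ← h₀.smul]
      refine add_le_add ?_ (WithBot.coe_le_coe.2 hi)
      conv_rhs => rw [← x.sum_repr (X.d v)]
      exact H.orthogonal₀ (x.repr (X.d v)) _
  · intro hk
    obtain ⟨T, hT, hTk⟩ := Finset.exists_subset_card_eq (n := k)
      (s := Finset.univ.filter fun i => δ < g i) (by rwa [← Fintype.card_subtype])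
    have hTδ : ∀ i ∈ T, δ < g i := fun i hi => by simpa using hT hi
    let b : T → C₀ := fun i => x (.inl i)
    have hb : LinearIndependent (NovikovField K Γ) b :=
      x.linearIndependent.comp (fun i : T => (.inl i : ρ ⊕ β))
        fun i j hij => Subtype.ext (Sum.inl_injective hij)
    refine ⟨Submodule.span _ (Set.range b), ?_, ?_, ?_⟩
    · rw [Submodule.span_le]
      rintro _ ⟨i, rfl⟩
      exact ⟨y (.inl i), H.map_inl i⟩
    · rintro z hz hz0 u rfl
      have hsupp : ∀ k : ρ ⊕ β, x.repr (X.d u) k ≠ 0 → ∃ i ∈ T, k = .inl i := by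
        intro k hk
        obtain ⟨a, ha⟩ := (Submodule.mem_span_range_iff_exists_fun _).1 hz
        by_contra! hne
        refine hk ?_
        rw [← ha, map_sum, Finsupp.finsetSum_apply]
        refine Finset.sum_eq_zero fun i _ => ?_
        simp [b, (hne i i.2).symm]
      -- A coordinate realizing the level of `X.d u`. It is nonzero, hence indexed by `T`, and every
      -- primitive `u` has this same coefficient along `y (.inl i)`, at a level higher by `g i > δ`.
      obtain ⟨k, hk⟩ : ∃ k, X.ℓ₀ (X.d u) ≤ X.ℓ₀ (x.repr (X.d u) k • x k) ∧
          x.repr (X.d u) k ≠ 0 := by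
        by_contra! hcon
        have hne : (Finset.univ : Finset (ρ ⊕ β)).Nonempty := by
          by_contra hempty
          rw [Finset.not_nonempty_iff_eq_empty] at hempty
          exact hz0 (by rw [← x.sum_repr (X.d u), hempty, Finset.sum_empty])
        obtain ⟨k, -, hk⟩ := Finset.exists_max_image Finset.univ
          (fun k => X.ℓ₀ (x.repr (X.d u) k • x k)) hne
        have hle : X.ℓ₀ (X.d u) ≤ X.ℓ₀ (x.repr (X.d u) k • x k) := by
          conv_lhs => rw [← x.sum_repr (X.d u)]
          exact h₀.sum_le _ _ hk
        have h0 := hcon k hle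
        rw [h0, zero_smul, h₀.map_zero, le_bot_iff, h₀.eq_bot_iff] at hle
        exact hz0 hle
      obtain ⟨i, hiT, rfl⟩ := hsupp k hk.2
      obtain ⟨v, hv⟩ := h₀.exists_eq_coe (smul_ne_zero hk.2 (x.ne_zero (.inl i)))
      calc X.ℓ₀ (X.d u) + ((δ : ℝ) : WithBot ℝ)
          ≤ X.ℓ₀ (x.repr (X.d u) (.inl i) • x (.inl i)) + ((δ : ℝ) : WithBot ℝ) :=
            add_le_add_left hk.1 _
        _ < X.ℓ₀ (x.repr (X.d u) (.inl i) • x (.inl i)) + ((g i : ℝ) : WithBot ℝ) := by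
            rw [hv, ← WithBot.coe_add, ← WithBot.coe_add, WithBot.coe_lt_coe]
            have : (δ : ℝ) < g i := hTδ i hiT
            linarith
        _ = X.ℓ₁ (y.repr u (.inl i) • y (.inl i)) := by
            rw [h₀.smul, h₁.smul, H.gap, H.repr_map_inl, add_right_comm]
        _ ≤ X.ℓ₁ u := by
            conv_rhs => rw [← y.sum_repr u]
            exact H.orthogonal₁ (y.repr u) _
    · rw [finrank_span_eq_card hb, Fintype.card_coe, hTk]

end IsSingularValueDecomposition

end TwoTermFloerComplex

theorem le_card_lt_iff {s : ℕ} {lam : Fin s → ℝ≥0} (hlam : Antitone lam) {k : ℕ} (hk : 1 ≤ k)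
    (t : ℝ≥0) : k ≤ Nat.card {i // t < lam i} ↔ (t : ℝ) < torsionExponent lam k := by
  classical
  rw [Nat.card_eq_fintype_card, Fintype.card_subtype]
  unfold torsionExponent
  split_ifs with h
  · rw [NNReal.coe_lt_coe]
    constructor
    · intro hle
      by_contra! hcon
      -- Indices start at `0`, so the `k`-th exponent sits at `k - 1`. If it is at most `t`,
      -- monotonicity leaves at most `k - 1` exponents above `t`.
      have hsub : (Finset.univ.filter fun i => t < lam i) ⊆
          Finset.univ.filter fun i : Fin s => (i : ℕ) < k - 1 := by
        intro i hi
        simp only [Finset.mem_filter, Finset.mem_univ, true_and] at hi ⊢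
        by_contra! hge
        exact hi.not_ge ((hlam (show (⟨k - 1, by omega⟩ : Fin s) ≤ i from hge)).trans hcon)
      have := Finset.card_le_card hsub
      rw [Fin.card_filter_val_lt] at this
      omega
    · intro hlt
      have hsub : (Finset.univ.filter fun i : Fin s => (i : ℕ) < k) ⊆
          Finset.univ.filter fun i => t < lam i := by
        intro i hi
        simp only [Finset.mem_filter, Finset.mem_univ, true_and] at hi ⊢
        exact hlt.trans_le (hlam (show i ≤ (⟨k - 1, by omega⟩ : Fin s) from
          Fin.le_def.2 (Nat.le_sub_one_of_lt hi)))
      have := Finset.card_le_card hsub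
      rw [Fin.card_filter_val_lt] at this
      omega
  · have h1 : (Finset.univ.filter fun i => t < lam i).card ≤ s :=
      (Finset.card_le_univ _).trans_eq (Fintype.card_fin s)
    have h2 : s < k := by
      by_contra! hcon
      exact h ⟨hk, hcon⟩
    exact iff_of_false (by omega) (not_lt.2 t.2)

theorem torsionExponent_nonneg {s : ℕ} (lam : Fin s → ℝ≥0) (k : ℕ) : 0 ≤ torsionExponent lam k := by
  unfold torsionExponent
  split_ifs
  · exact NNReal.coe_nonneg _
  · exact le_rfl

end Main

theorem theorem4p5 {K : Type*} [Field K] {Γ : AddSubgroup ℝ} {C₁ C₀ : Type*}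
    [AddCommGroup C₁] [Module (NovikovField K Γ) C₁]
    [AddCommGroup C₀] [Module (NovikovField K Γ) C₀]
    (X : TwoTermFloerComplex K Γ C₁ C₀)
    {n₁ n₀ : ℕ} (w₁ : Module.Basis (Fin n₁) (NovikovField K Γ) C₁)
    (w₀ : Module.Basis (Fin n₀) (NovikovField K Γ) C₀)
    (hw₁ : IsOrthogonal (K := K) (Γ := Γ) X.ℓ₁ w₁)
    (hw₀ : IsOrthogonal (K := K) (Γ := Γ) X.ℓ₀ w₀) :
    (∃ (q s : ℕ) (lam : Fin s → NNReal), X.IsTorsionDecomposition w₁ hw₀ q s lam) ∧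
    ∀ (q s : ℕ) (lam : Fin s → NNReal), X.IsTorsionDecomposition w₁ hw₀ q s lam →
      ∀ k : ℕ, 1 ≤ k → (torsionExponent lam k : EReal) = X.boundaryDepth k := by
  obtain ⟨ρ, α, β, _, _, _, y, x, g, H⟩ := X.exists_isSingularValueDecomposition hw₁ hw₀
  refine ⟨H.exists_isTorsionDecomposition hw₁ hw₀, fun q s lam hlam k hk => ?_⟩
  have key : ∀ δ : ℝ≥0, (∃ V : Submodule (NovikovField K Γ) C₀, V ≤ LinearMap.range X.d ∧
      X.IsRobustSubspace δ V ∧ Module.finrank (NovikovField K Γ) V = k) ↔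
      (δ : ℝ) < torsionExponent lam k := fun δ => by
    rw [H.exists_isRobustSubspace_iff, ← H.card_gap_eq hw₁ hw₀ hlam, le_card_lt_iff hlam.1 hk]
  refine le_antisymm ?_ (sSup_le ?_)
  -- Negative `c` lie below the element `0` of the set. For `c ≥ 0`, a real `δ` strictly between `c`
  -- and the exponent is admissible; the exponent itself need not be attained.
  · refine le_of_forall_lt fun c hc => ?_
    rcases lt_or_ge c 0 with h0 | h0
    · exact h0.trans_le (le_sSup (Or.inl rfl))
    · obtain ⟨δ, hcδ, hδ⟩ := EReal.exists_between_coe_real hc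
      have hδ0 : 0 ≤ δ := EReal.coe_nonneg.1 (h0.trans hcδ.le)
      exact hcδ.trans_le (le_sSup (Or.inr ⟨δ, hδ0, rfl,
        (key ⟨δ, hδ0⟩).2 (EReal.coe_lt_coe_iff.1 hδ)⟩))
  · rintro _ (rfl | ⟨δ, hδ0, rfl, hV⟩)
    · exact EReal.coe_nonneg.2 (torsionExponent_nonneg lam k)
    · exact EReal.coe_le_coe_iff.2 ((key ⟨δ, hδ0⟩).1 hV).le

end
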